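/- Let $C^\infty(-2\pi,2\pi)$ be the space of smooth complex-valued functions on $(-2\pi,2\pi)$ with the topology of uniform convergence on compacta of each derivative, and let $D=\frac{d}{dx}$. There exists a closed subspace $L$ of $C^\infty(-2\pi,2\pi)$ with $DL\subset L$ such that the spectrum $\sigma(D|_L)$ of the continuous operator $D|_L:L\to L$ is a nonempty discrete subset of $\mathbb C$ (without accumulation points in $\mathbb C$) consisting of eigenvalues of $D|_L$, and such that the following hold. (1) The residual part $L_{res}=\bigcap\{p(D)L:\ p\neq 0\text{ a polynomial}\}$ of $L$ is $$L_{res}=\{f\in C^\infty(-2\pi,2\pi):\ f|_{[-\pi,\pi]}\equiv 0\}.$$ (2) The spectrum has uniform upper density equal to $1$, i.e., counting points of $\sigma(D|_L)$ with multiplicities (the multiplicity of $\lambda$ being the dimension of the root space $\bigcup_k\ker(D|_L-\lambda)^k$), $$\mathcal D_+(\sigma(D|_L)):=\lim_{r\to\infty}\sup_{x\in\mathbb R}\frac{\operatorname{card}\{\lambda\in\sigma(D|_L):\ \operatorname{Im}\lambda\in[x,x+r]\}}{r}=1,$$ which is the critical value $|I|/2\pi$ for the interval $I=[-\pi,\pi]$.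 (3) $L\neq\overline{L_{res}+\mathcal E(L)}$, where $\mathcal E(L)$ is the set of monomial exponentials $x\mapsto x^k e^{\lambda x}$ ($k\ge 0$ an integer, $\lambda\in\mathbb C$) contained in $L$, and $\overline{L_{res}+\mathcal E(L)}$ is the closed linear span of $L_{res}\cup\mathcal E(L)$. -/

import Mathlib

open Set Filter Topology
open scoped ContDiff ENNReal Polynomial

noncomputable section

namespace DiffInv

/-- The vector space underlying `C^∞(a,b)`: complex-valued functions that are smooth on the open
interval `(a,b)`. A function on `(a,b)` is represented by its extension by zero to the line, so
that two elements are equal exactly when they agree on `(a,b)`. -/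
def smoothSubmodule (a b : ℝ) : Submodule ℂ (ℝ → ℂ) where
  carrier := {f | ContDiffOn ℝ ∞ f (Ioo a b) ∧ ∀ x ∉ Ioo a b, f x = 0}
  add_mem' := fun {f g} hf hg =>
    ⟨hf.1.add hg.1, fun x hx => by simp [hf.2 x hx, hg.2 x hx]⟩
  zero_mem' := ⟨contDiffOn_const, fun _ _ => rfl⟩
  smul_mem' := fun c f hf =>
    ⟨contDiffOn_const.smul hf.1, fun x hx => by simp [hf.2 x hx]⟩

/-- The space `C^∞(a,b)`. (A separate type, so that it does not inherit the topology of pointwise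
convergence.) -/
def SmoothFun (a b : ℝ) : Type := ↥(smoothSubmodule a b)

variable {a b : ℝ}

instance : AddCommGroup (SmoothFun a b) := inferInstanceAs (AddCommGroup ↥(smoothSubmodule a b))
instance : Module ℂ (SmoothFun a b) := inferInstanceAs (Module ℂ ↥(smoothSubmodule a b))
instance : CoeFun (SmoothFun a b) (fun _ => ℝ → ℂ) := ⟨fun f => f.1⟩

/-- The element of `C^∞(a,b)` given by a function which is smooth on `(a,b)`. -/
def SmoothFun.mk (f : ℝ → ℂ) (hf : ContDiffOn ℝ ∞ f (Ioo a b)) : SmoothFun a b :=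
  ⟨(Ioo a b).indicator f,
    hf.congr fun _ hx => indicator_of_mem hx f, fun _ hx => indicator_of_notMem hx f⟩

theorem SmoothFun.contDiffOn (f : SmoothFun a b) : ContDiffOn ℝ ∞ f (Ioo a b) := f.2.1

theorem SmoothFun.contDiffOn_deriv (f : SmoothFun a b) :
    ContDiffOn ℝ ∞ (deriv f) (Ioo a b) :=
  f.contDiffOn.deriv_of_isOpen isOpen_Ioo (by simp)

theorem SmoothFun.differentiableAt (f : SmoothFun a b) {x : ℝ} (hx : x ∈ Ioo a b) :
    DifferentiableAt ℝ f x :=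
  (f.contDiffOn.differentiableOn (by simp)).differentiableAt (isOpen_Ioo.mem_nhds hx)

/-- The differentiation operator `D = d/dx` on `C^∞(a,b)`, as a linear map. -/
def derivLin (a b : ℝ) : SmoothFun a b →ₗ[ℂ] SmoothFun a b where
  toFun f := SmoothFun.mk (deriv f) f.contDiffOn_deriv
  map_add' f g := Subtype.ext <| funext fun x => by
    change (Ioo a b).indicator (deriv (fun y => f y + g y)) x =
      (Ioo a b).indicator (deriv f) x + (Ioo a b).indicator (deriv g) x
    by_cases hx : x ∈ Ioo a b
    · simp only [indicator_of_mem hx]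
      exact deriv_fun_add (f.differentiableAt hx) (g.differentiableAt hx)
    · simp [indicator_of_notMem hx]
  map_smul' c f := Subtype.ext <| funext fun x => by
    change (Ioo a b).indicator (deriv (fun y => c • f y)) x =
      c • (Ioo a b).indicator (deriv f) x
    by_cases hx : x ∈ Ioo a b
    · simp only [indicator_of_mem hx]
      exact deriv_fun_const_smul c (f.differentiableAt hx)
    · simp [indicator_of_notMem hx]

/-- An element of `C^∞(a,b)` as a continuous function on the subtype `(a,b)`. -/
def toContinuous (a b : ℝ) : SmoothFun a b →ₗ[ℂ] C(Ioo a b, ℂ) where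
  toFun f := ⟨(Ioo a b).domRestrict f, f.contDiffOn.continuousOn.domRestrict⟩
  map_add' _ _ := rfl
  map_smul' _ _ := rfl

/-- The topology of `C^∞(a,b)`: uniform convergence on compact subsets of `(a,b)` of each
derivative. (The topology of `C(Ioo a b, ℂ)` is the compact-open topology.) -/
instance : TopologicalSpace (SmoothFun a b) :=
  ⨅ k : ℕ, TopologicalSpace.induced (fun f => toContinuous a b ((derivLin a b ^ k) f)) inferInstance

instance : IsTopologicalAddGroup (SmoothFun a b) :=
  topologicalAddGroup_iInf fun k =>
    topologicalAddGroup_induced ((toContinuous a b) ∘ₗ (derivLin a b ^ k))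

instance : ContinuousSMul ℂ (SmoothFun a b) :=
  continuousSMul_iInf fun k =>
    continuousSMul_induced ((toContinuous a b) ∘ₗ (derivLin a b ^ k))

/-- The differentiation operator `D = d/dx` as a continuous operator on `C^∞(a,b)`. -/
def D (a b : ℝ) : SmoothFun a b →L[ℂ] SmoothFun a b where
  toLinearMap := derivLin a b
  cont := by
    refine continuous_iInf_rng.2 fun k => continuous_induced_rng.2 ?_
    have h : Continuous fun f : SmoothFun a b => toContinuous a b ((derivLin a b ^ (k + 1)) f) :=
      continuous_iInf_dom (i := k + 1) continuous_induced_dom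
    refine h.congr fun f => ?_
    simp [pow_succ]

/-- `L` is a `D`-invariant subspace: closed, with `D L ⊆ L`. -/
structure IsInvariantSubspace (L : Submodule ℂ (SmoothFun a b)) : Prop where
  isClosed : IsClosed (L : Set (SmoothFun a b))
  map_mem : ∀ f ∈ L, D a b f ∈ L

/-- The restriction `D|_L`, a continuous operator on `L`. -/
def restrictD {L : Submodule ℂ (SmoothFun a b)} (hL : IsInvariantSubspace L) : L →L[ℂ] L :=
  (D a b).restrict hL.map_mem

/-- The spectrum `σ(D|_L)`: the `z` for which `z - D|_L` has no continuous inverse on `L`. -/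
def spec {L : Submodule ℂ (SmoothFun a b)} (hL : IsInvariantSubspace L) : Set ℂ :=
  spectrum ℂ (restrictD hL)

/-- The spectrum of `D|_L` is a nonempty discrete set (no accumulation point in `ℂ`) of
eigenvalues. -/
structure HasDiscreteSpectrum {L : Submodule ℂ (SmoothFun a b)}
    (hL : IsInvariantSubspace L) : Prop where
  nonempty : (spec hL).Nonempty
  discrete : ∀ z : ℂ, ¬ AccPt z (𝓟 (spec hL))
  eigenvalue : ∀ z ∈ spec hL,
    Module.End.HasEigenvalue (restrictD hL : Module.End ℂ L) z

/-- The multiplicity of a point of the spectrum of `D|_L`: the dimension (possibly `∞`) of its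
root space. -/
def specMultiplicity {L : Submodule ℂ (SmoothFun a b)} (hL : IsInvariantSubspace L) (z : ℂ) : ℕ∞ :=
  Cardinal.toENat
    (Module.rank ℂ ↥(Module.End.maxGenEigenspace (restrictD hL : Module.End ℂ L) z))

/-- The number, with multiplicities, of points of `σ(D|_L)` with imaginary part in
`[x, x + r]`. -/
def specCount {L : Submodule ℂ (SmoothFun a b)} (hL : IsInvariantSubspace L) (x r : ℝ) : ℝ≥0∞ :=
  ∑' z : {z : ℂ // z ∈ spec hL ∧ z.im ∈ Icc x (x + r)}, (specMultiplicity hL z : ℝ≥0∞)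

/-- `σ(D|_L)` has uniform upper density `d`:
`lim_{r → ∞} sup_x card {z ∈ σ(D|_L) : Im z ∈ [x, x + r]} / r = d`. -/
def HasUpperDensity {L : Submodule ℂ (SmoothFun a b)} (hL : IsInvariantSubspace L)
    (d : ℝ≥0∞) : Prop :=
  Tendsto (fun r : ℝ => (⨆ x : ℝ, specCount hL x r) / ENNReal.ofReal r) atTop (𝓝 d)

/-- The residual part `L_res = ⋂ p(D) L`, over all nonzero polynomials `p`. -/
def residualPart (L : Submodule ℂ (SmoothFun a b)) : Submodule ℂ (SmoothFun a b) :=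
  ⨅ (p : ℂ[X]) (_ : p ≠ 0), L.map (Polynomial.aeval (derivLin a b) p)

/-- The monomial exponential `x ↦ x ^ n * exp (z x)` in `C^∞(a,b)`. -/
def monomialExp (a b : ℝ) (n : ℕ) (z : ℂ) : SmoothFun a b :=
  SmoothFun.mk (fun x : ℝ => (x : ℂ) ^ n * Complex.exp (z * x)) <| by
    have h : ContDiff ℝ ∞ (fun x : ℝ => (x : ℂ)) := Complex.ofRealCLM.contDiff
    exact ((h.pow n).mul (contDiff_const.mul h).cexp).contDiffOn

/-- `𝓔(L)`: the set of monomial exponentials contained in `L`. -/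
def monomialExps (L : Submodule ℂ (SmoothFun a b)) : Set (SmoothFun a b) :=
  {f | f ∈ L ∧ ∃ (n : ℕ) (z : ℂ), f = monomialExp a b n z}

/-- The closure of `L_res + 𝓔(L)`, i.e. the closed subspace generated by the residual part of `L`
and the monomial exponentials in `L`. -/
def synthesisPart (L : Submodule ℂ (SmoothFun a b)) : Submodule ℂ (SmoothFun a b) :=
  (residualPart L ⊔ Submodule.span ℂ (monomialExps L)).topologicalClosure

end DiffInv

end

/-! The invariant subspace is built from the theta functional
`θ(f) = ∑ₖ ∫_{-π}^{π} f(x) e^{-ik²x} dx`, the sum over all integers `k`; it converges because the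
Fourier coefficients of a smooth function on `[-π, π]` are `O(1/n)`. Let `L = thetaSpace` be the set
of all `f` with `θ(f⁽ʲ⁾) = 0` for every `j`.

*Spectrum.* If `g' - z g = f`, integration by parts gives the Fourier coefficients
`(z - in) cₙ(g) = (-1)ⁿ (g(π) - g(-π)) - cₙ(f)`, so that `θ(g)` involves the series
`∑ (-1)ᵏ / (z - ik²)`, a cosecant in the variable `√(-iz)` which has no zeros. With `f = 0` one sees
that `e^{zx} ∈ L` exactly when `z = in` for an integer `n` which is not a square; a second
application shows that these eigenvalues are semisimple. For every other `z`, a solution of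
`g' - z g = f` can be corrected by a multiple of `e^{zx}` to satisfy `θ(g) = 0`, and then it lies in
`L` whenever `f` does; this is the resolvent. So the spectrum is `i` times the nonsquare integers.
Each has multiplicity one, and there are no squares on the negative half-line, so the upper density
is `1`.

*Residual part.* Functions vanishing on `[-π, π]` lie in the residual part because `p(D) g = f` can
be solved starting from `0` (`exists_aeval_eq`). Conversely let `f` be in the residual part. Solving
`g' + im² g = f` in `L` shows that the cosine series `B(t) = ∑ c_{k²}(f) cos(kt)` satisfies
`∫_0^π B(t) cosh(m(π - t)) dt = π (g(π) - g(-π))`, which is bounded in `m`, as its modulus is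
`π |c_{-m²}(f)|`. By Mikusiński's lemma (`eq_zero_of_exp_moments_bounded`) `B` vanishes. Hence the
coefficients of `f` of square index vanish, then so do all the others, and `f = 0` on `[-π, π]`.

*Failure of synthesis.* The Fourier coefficient of index `1` vanishes on the residual part and on
every monomial exponential in `L`, since `1` is a square. It does not vanish on all of `L`: take a
bump function `φ ≥ 0` supported in `[1/4, 3/4]`, where `cos(2πx) ≤ 0`. By Poisson summation its
Fourier transform satisfies `∑ kʲ φ̂(k) = 0` for all `j`, whence `∑ k² φ̂(k) e^{ik²x}` lies in `L`,
while its coefficient of index `1` is a multiple of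
`φ̂(1) + φ̂(-1) = 2 ∫ cos(2πx) φ(x) dx ≠ 0`. -/

noncomputable section

open MeasureTheory

namespace DiffInv

/-! ### Cosecant series and bounded exponential moments -/

theorem summable_inv_one_add_sq : Summable fun k : ℤ => 1 / (1 + (k : ℝ) ^ 2) := by
  have h : Summable fun k : ℤ => 1 / |(k : ℝ)| ^ 2 := by
    simpa using (Real.summable_one_div_int_pow (p := 2)).2 (by norm_num)
  refine Summable.of_norm_bounded_eventually h ?_
  filter_upwards [(Set.finite_singleton (0 : ℤ)).compl_mem_cofinite] with k hk
  have hk' : (k : ℝ) ≠ 0 := by simpa using hk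
  rw [Real.norm_of_nonneg (by positivity), sq_abs]
  exact one_div_le_one_div_of_le (by positivity) (by linarith)

/-- The Mittag-Leffler expansion of the cosecant, obtained from that of the cotangent through
`csc x = cot (x / 2) - cot x`. -/
theorem csc_series {w : ℂ} (hw : w ∈ Complex.integerComplement) :
    ∑' k : ℤ, (-1 : ℂ) ^ k / (w ^ 2 - (k : ℂ) ^ 2) = Real.pi / (w * Complex.sin (Real.pi * w)) := by
  have hw2 : w / 2 ∈ Complex.integerComplement := by
    rintro ⟨n, hn⟩
    exact hw ⟨2 * n, by push_cast; rw [hn]; ring⟩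
  have hne : ∀ k : ℤ, w - k ≠ 0 := fun k h => hw ⟨k, (sub_eq_zero.1 h).symm⟩
  have hw0 : w ≠ 0 := by simpa using hne 0
  set u : ℕ → ℂ := fun n => 1 / (w - (n + 1)) + 1 / (w + (n + 1)) with hu
  have hsu : Summable u := by
    simpa [hu, cotTerm] using summable_cotTerm hw
  have h1 := cot_series_rep' hw
  have h2 := cot_series_rep' hw2
  have hev : Summable fun n : ℕ => u (2 * n) :=
    hsu.comp_injective (mul_right_injective₀ two_ne_zero)
  have hod : Summable fun n : ℕ => u (2 * n + 1) :=
    hsu.comp_injective fun a b h => by simpa using h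
  have h3 : ∑' n : ℕ, (1 / (w / 2 - (n + 1)) + 1 / (w / 2 + (n + 1))) =
      2 * ∑' n : ℕ, u (2 * n + 1) := by
    rw [← tsum_mul_left]
    refine tsum_congr fun n => ?_
    have e1 : w - (((2 * n + 1 : ℕ) : ℂ) + 1) ≠ 0 := by
      have := hne (2 * n + 2); push_cast at this ⊢
      convert this using 2; ring
    have e2 : w + (((2 * n + 1 : ℕ) : ℂ) + 1) ≠ 0 := by
      have := hne (-(2 * n + 2)); push_cast at this ⊢
      convert this using 1; ring
    have e3 : w / 2 - (n + 1) = (w - (((2 * n + 1 : ℕ) : ℂ) + 1)) / 2 := by push_cast; ring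
    have e4 : w / 2 + (n + 1) = (w + (((2 * n + 1 : ℕ) : ℂ) + 1)) / 2 := by push_cast; ring
    rw [e3, e4, hu]
    field_simp
  have h4 : ∑' n : ℕ, (-1 : ℂ) ^ (n + 1) * u n =
      ∑' n : ℕ, u (2 * n + 1) - ∑' n : ℕ, u (2 * n) := by
    have a1 : ∀ n : ℕ, (-1 : ℂ) ^ (2 * n + 1) * u (2 * n) = - u (2 * n) := fun n => by
      rw [Odd.neg_one_pow (by simp)]; ring
    have a2 : ∀ n : ℕ, (-1 : ℂ) ^ (2 * n + 1 + 1) * u (2 * n + 1) = u (2 * n + 1) := fun n => by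
      rw [Even.neg_one_pow ⟨n + 1, by ring⟩]; ring
    rw [← tsum_even_add_odd (f := fun n : ℕ => (-1 : ℂ) ^ (n + 1) * u n)]
    · simp only [a1, a2, tsum_neg]; ring
    · simpa only [a1] using hev.neg
    · simpa only [a2] using hod
  have h5 : ∑' n : ℕ, u n = ∑' n : ℕ, u (2 * n) + ∑' n : ℕ, u (2 * n + 1) :=
    (tsum_even_add_odd hev hod).symm
  have hterm : ∀ n : ℕ, (-1 : ℂ) ^ (n + 1) * u n =
      (2 * w) * ((-1 : ℂ) ^ ((n : ℤ) + 1) / (w ^ 2 - (((n : ℤ) + 1 : ℤ) : ℂ) ^ 2)) := fun n => by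
    have e1 : w - (n + 1) ≠ 0 := by simpa using hne (n + 1)
    have e2 : w + (n + 1) ≠ 0 := by
      have := hne (-(n + 1)); push_cast at this
      convert this using 1; ring
    have e3 : w ^ 2 - (((n : ℤ) + 1 : ℤ) : ℂ) ^ 2 = (w - (n + 1)) * (w + (n + 1)) := by
      push_cast; ring
    have e4 : (-1 : ℂ) ^ ((n : ℤ) + 1) = (-1 : ℂ) ^ (n + 1) := by
      exact_mod_cast zpow_natCast (-1 : ℂ) (n + 1)
    rw [e3, e4, hu]
    field_simp
    ring
  have hsv : Summable fun n : ℕ => (-1 : ℂ) ^ (n + 1) * u n := by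
    refine hsu.norm.of_norm_bounded fun n => ?_
    simp
  have hpos : Summable fun n : ℕ =>
      (-1 : ℂ) ^ ((n : ℤ) + 1) / (w ^ 2 - (((n : ℤ) + 1 : ℤ) : ℂ) ^ 2) := by
    have := hsv.mul_left (2 * w)⁻¹
    refine this.congr fun n => ?_
    rw [hterm n]
    field_simp
  have heven : ∀ k : ℤ, (-1 : ℂ) ^ (-k) / (w ^ 2 - ((-k : ℤ) : ℂ) ^ 2) =
      (-1 : ℂ) ^ k / (w ^ 2 - (k : ℂ) ^ 2) := fun k => by
    congr 1
    · rw [zpow_neg, ← inv_zpow]; norm_num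
    · push_cast; ring
  set F : ℤ → ℂ := fun k => (-1 : ℂ) ^ k / (w ^ 2 - (k : ℂ) ^ 2) with hF
  have hnat : Summable fun n : ℕ => F n := by
    rw [← summable_nat_add_iff 1]
    simpa [hF] using hpos
  have hneg : ∀ n : ℕ, F (-((n : ℤ) + 1)) = F ((n : ℤ) + 1) := fun n => heven _
  have hsplit : ∑' k : ℤ, F k = ∑' n : ℕ, F n + ∑' n : ℕ, F ((n : ℤ) + 1) := by
    have := tsum_of_nat_of_neg_add_one hnat (by simpa only [hneg] using hpos)
    simpa only [hneg] using this
  have hzero : ∑' n : ℕ, F n = F 0 + ∑' n : ℕ, F ((n : ℤ) + 1) := by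
    simpa using hnat.tsum_eq_zero_add
  have h6 : ∑' n : ℕ, (-1 : ℂ) ^ (n + 1) * u n = 2 * w * ∑' n : ℕ, F ((n : ℤ) + 1) := by
    rw [← tsum_mul_left]
    exact tsum_congr hterm
  have hF0 : F 0 = 1 / w ^ 2 := by simp [hF]
  have hs1 : Complex.sin (Real.pi * w) ≠ 0 := by
    intro h
    obtain ⟨k, hk⟩ := Complex.sin_eq_zero_iff.1 h
    refine hne k ?_
    have hpi : (Real.pi : ℂ) ≠ 0 := by exact_mod_cast Real.pi_ne_zero
    have : (Real.pi : ℂ) * (w - k) = 0 := by rw [mul_sub, hk]; ring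
    exact (mul_eq_zero.1 this).resolve_left hpi
  have hdouble : (Real.pi : ℂ) * w = 2 * (Real.pi * (w / 2)) := by ring
  have hs2 : Complex.sin (Real.pi * (w / 2)) ≠ 0 := by
    intro h
    apply hs1
    rw [hdouble, Complex.sin_two_mul, h]; simp
  have hc2 : Complex.cos (Real.pi * (w / 2)) ≠ 0 := by
    intro h
    apply hs1
    rw [hdouble, Complex.sin_two_mul, h]; simp
  have htrig : Complex.cot (Real.pi * (w / 2)) - Complex.cot (Real.pi * w) =
      1 / Complex.sin (Real.pi * w) := by
    rw [Complex.cot, Complex.cot, hdouble, Complex.sin_two_mul, Complex.cos_two_mul]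
    field_simp
    ring
  rw [hsplit, hzero, hF0]
  have h7 : 2 * w * ∑' n : ℕ, F ((n : ℤ) + 1) =
      Real.pi * (1 / Complex.sin (Real.pi * w)) - 1 / w := by
    rw [← h6, h4, ← htrig]
    rw [h3] at h2
    rw [h5] at h1
    have e : (1 : ℂ) / (w / 2) = 2 / w := by field_simp
    rw [e] at h2
    have e' : (2 : ℂ) / w = 1 / w + 1 / w := by ring
    rw [e'] at h2
    linear_combination (-1 : ℂ) * h2 + h1
  have h8 : ∑' n : ℕ, F ((n : ℤ) + 1) =
      (Real.pi * (1 / Complex.sin (Real.pi * w)) - 1 / w) / (2 * w) := by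
    rw [← h7]; field_simp
  rw [h8]
  field_simp
  ring

/-- Mikusiński's lemma: a continuous function on `[0, a]` all of whose exponential moments of
integer order stay bounded vanishes. -/
theorem eq_zero_of_exp_moments_bounded {a M : ℝ} {f : ℝ → ℂ} (hf : Continuous f)
    (hM : ∀ n : ℕ, ‖∫ x in (0 : ℝ)..a, Real.exp (n * x) * f x‖ ≤ M) :
    ∀ x ∈ Ioo 0 a, f x = 0 := by
  have key : ∀ t ∈ Ioo 0 a, ∫ x in t..a, f x = 0 := by
    intro t ht
    -- For fixed `n`, expand `1 - exp (-exp (n (x - t)))` in a power series in `exp (n (x - t))`.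
    have hser : ∀ n : ℕ,
        ‖∫ x in (0 : ℝ)..a, ((1 - Real.exp (-Real.exp (n * (x - t))) : ℝ) : ℂ) * f x‖ ≤
         M * (Real.exp (Real.exp (-(n * t))) - 1) := by
      intro n
      let g : ℕ → C(ℝ, ℂ) := fun k =>
        ⟨fun x => ((-(-Real.exp (n * (x - t))) ^ (k + 1) / (k + 1).factorial : ℝ) : ℂ) * f x,
          by fun_prop⟩
      have hmom : ∀ k : ℕ, ‖∫ x in (0 : ℝ)..a, g k x‖ ≤
          M * (Real.exp (-(n * t)) ^ (k + 1) / (k + 1).factorial) := by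
        intro k
        have e : ∀ x : ℝ, g k x = ((-(-1 : ℝ) ^ (k + 1) * (Real.exp (-(n * t)) ^ (k + 1) /
            (k + 1).factorial) : ℝ) : ℂ) * (Real.exp ((n * (k + 1) : ℕ) * x) * f x) := by
          intro x
          have : Real.exp (n * (x - t)) ^ (k + 1) =
              Real.exp (-(n * t)) ^ (k + 1) * Real.exp ((n * (k + 1) : ℕ) * x) := by
            rw [← Real.exp_nat_mul, ← Real.exp_nat_mul, ← Real.exp_add]
            congr 1; push_cast; ring
          change ((-(-Real.exp (n * (x - t))) ^ (k + 1) / (k + 1).factorial : ℝ) : ℂ) * f x = _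
          rw [neg_pow, this]
          push_cast; ring
        simp only [e]
        rw [intervalIntegral.integral_const_mul, norm_mul, Complex.norm_real, norm_mul, norm_neg,
          norm_pow, norm_neg, norm_one, one_pow, one_mul, Real.norm_of_nonneg (by positivity),
          mul_comm M]
        exact mul_le_mul_of_nonneg_left (hM _) (by positivity)
      have hexp : ∀ y : ℝ, HasSum (fun k : ℕ => y ^ (k + 1) / (k + 1).factorial)
          (Real.exp y - 1) := by
        intro y
        have h := NormedSpace.expSeries_div_hasSum_exp (𝔸 := ℝ) y
        rw [← Real.exp_eq_exp_ℝ] at h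
        simpa using (hasSum_nat_add_iff' 1).2 h
      have hsum : Summable fun k =>
          ‖(g k).restrict (⟨uIcc 0 a, isCompact_uIcc⟩ : TopologicalSpace.Compacts ℝ)‖ := by
        obtain ⟨C, hC⟩ := (isCompact_uIcc (a := (0 : ℝ)) (b := a)).exists_bound_of_continuousOn
          hf.continuousOn
        obtain ⟨C', hC'⟩ := (isCompact_uIcc (a := (0 : ℝ)) (b := a)).exists_bound_of_continuousOn
          (f := fun x => Real.exp (n * (x - t))) (by fun_prop)
        refine Summable.of_nonneg_of_le (fun _ => norm_nonneg _) (fun k => ?_)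
          ((hexp |C'|).summable.mul_right |C|)
        refine (ContinuousMap.norm_le _ (by positivity)).2 fun x => ?_
        change ‖((-(-Real.exp (n * (x - t))) ^ (k + 1) / (k + 1).factorial : ℝ) : ℂ) * f x‖ ≤ _
        rw [norm_mul, Complex.norm_real, norm_div, norm_neg, norm_pow, norm_neg]
        have h1 := (hC x x.2).trans (le_abs_self C)
        have h2 := (hC' x x.2).trans (le_abs_self C')
        rw [Real.norm_of_nonneg (r := ((k + 1).factorial : ℝ)) (by positivity)]
        gcongr
      have hint := intervalIntegral.hasSum_intervalIntegral_of_summable_norm (a := 0) (b := a)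
        hsum
      have hpt : ∀ x : ℝ, ∑' k, g k x =
          ((1 - Real.exp (-Real.exp (n * (x - t))) : ℝ) : ℂ) * f x := by
        intro x
        have h := (hexp (-Real.exp (n * (x - t)))).neg
        have h' := (Complex.hasSum_ofReal.2 h).mul_right (f x)
        rw [neg_sub] at h'
        rw [← h'.tsum_eq]
        refine tsum_congr fun k => ?_
        change ((-(-Real.exp (n * (x - t))) ^ (k + 1) / (k + 1).factorial : ℝ) : ℂ) * f x = _
        rw [neg_div]
      simp only [hpt] at hint
      rw [← hint.tsum_eq]
      exact tsum_of_norm_bounded ((hexp _).mul_left M) hmom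
    have hlim0 : Tendsto (fun n : ℕ => M * (Real.exp (Real.exp (-(n * t))) - 1)) atTop (𝓝 0) := by
      have h1 : Tendsto (fun n : ℕ => -((n : ℝ) * t)) atTop atBot :=
        tendsto_neg_atTop_atBot.comp (tendsto_natCast_atTop_atTop.atTop_mul_const ht.1)
      have h2 := (Real.tendsto_exp_atBot.comp h1)
      have h3 := ((Real.continuous_exp.tendsto 0).comp h2).sub_const 1
      simpa [Function.comp_def] using h3.const_mul M
    -- The weights `1 - exp (-exp (n (x - t)))` tend to the indicator function of `x > t`.
    have hlim1 : Tendsto (fun n : ℕ => ∫ x in (0 : ℝ)..a,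
        ((1 - Real.exp (-Real.exp (n * (x - t))) : ℝ) : ℂ) * f x) atTop
        (𝓝 (∫ x in (0 : ℝ)..a, (Ioi t).indicator f x)) := by
      refine intervalIntegral.tendsto_integral_filter_of_dominated_convergence (fun x => ‖f x‖)
        (Eventually.of_forall fun n => ?_) (Eventually.of_forall fun n => ?_) ?_ ?_
      · exact Continuous.aestronglyMeasurable (by fun_prop)
      · refine Eventually.of_forall fun x _ => ?_
        rw [norm_mul, Complex.norm_real]
        have h1 : 0 < Real.exp (-Real.exp (n * (x - t))) := Real.exp_pos _
        have h2 : Real.exp (-Real.exp (n * (x - t))) ≤ 1 :=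
          Real.exp_le_one_iff.2 (neg_nonpos.2 (Real.exp_pos _).le)
        rw [Real.norm_of_nonneg (by linarith)]
        exact mul_le_of_le_one_left (norm_nonneg _) (by linarith)
      · exact hf.norm.intervalIntegrable _ _
      · have : ∀ᵐ x : ℝ, x ≠ t := by simp [ae_iff, measure_singleton]
        filter_upwards [this] with x hx _
        rcases lt_or_gt_of_ne hx with h | h
        · rw [indicator_of_notMem (by simpa using h.le)]
          have h1 : Tendsto (fun n : ℕ => (n : ℝ) * (x - t)) atTop atBot :=
            tendsto_natCast_atTop_atTop.atTop_mul_const_of_neg (by linarith)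
          have h2 := Real.tendsto_exp_atBot.comp h1
          have h3 := ((Real.continuous_exp.tendsto _).comp h2.neg).const_sub 1
          have h4 := ((Complex.continuous_ofReal.tendsto _).comp h3).mul_const (f x)
          simpa [Function.comp_def] using h4
        · rw [indicator_of_mem (by simpa using h)]
          have h1 : Tendsto (fun n : ℕ => (n : ℝ) * (x - t)) atTop atTop :=
            tendsto_natCast_atTop_atTop.atTop_mul_const (by linarith)
          have h2 := Real.tendsto_exp_atTop.comp h1
          have h3 := (Real.tendsto_exp_atBot.comp (tendsto_neg_atTop_atBot.comp h2)).const_sub 1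
          have h4 := ((Complex.continuous_ofReal.tendsto _).comp h3).mul_const (f x)
          simpa [Function.comp_def] using h4
    have hz : ∫ x in (0 : ℝ)..a, (Ioi t).indicator f x = 0 := by
      refine tendsto_nhds_unique hlim1 (squeeze_zero_norm hser hlim0)
    rw [intervalIntegral.integral_of_le (ht.1.trans ht.2).le,
      setIntegral_indicator measurableSet_Ioi] at hz
    rw [intervalIntegral.integral_of_le ht.2.le, ← hz]
    congr 2
    ext x
    simp only [mem_Ioc, mem_inter_iff, mem_Ioi]
    constructor
    · rintro ⟨h1, h2⟩; exact ⟨⟨ht.1.trans h1, h2⟩, h1⟩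
    · rintro ⟨⟨_, h2⟩, h1⟩; exact ⟨h1, h2⟩
  intro x hx
  have h1 : HasDerivAt (fun t => ∫ y in t..a, f y) (-f x) x :=
    intervalIntegral.integral_hasDerivAt_left (hf.intervalIntegrable _ _)
      (hf.stronglyMeasurableAtFilter _ _) hf.continuousAt
  have h2 : HasDerivAt (fun t => ∫ y in t..a, f y) 0 x :=
    (hasDerivAt_const x (0 : ℂ)).congr_of_eventuallyEq
      (eventually_of_mem (isOpen_Ioo.mem_nhds hx) key)
  simpa using h1.unique h2

/-! ### Fourier coefficients, the theta functional and its invariant subspace -/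

/-- The space `C^∞(-2π, 2π)`. -/
abbrev X : Type := SmoothFun (-2 * Real.pi) (2 * Real.pi)

/-- The operator `d/dx` on `C^∞(-2π, 2π)`, as a linear map. -/
abbrev dX : X →ₗ[ℂ] X := derivLin (-2 * Real.pi) (2 * Real.pi)

theorem Icc_subset : Icc (-Real.pi) Real.pi ⊆ Ioo (-2 * Real.pi) (2 * Real.pi) := by
  intro x hx
  have := Real.pi_pos
  exact ⟨by linarith [hx.1], by linarith [hx.2]⟩

theorem SmoothFun.ext' {a b : ℝ} {f g : SmoothFun a b} (h : ∀ x ∈ Ioo a b, f x = g x) : f = g :=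
  Subtype.ext <| funext fun x => by
    by_cases hx : x ∈ Ioo a b
    · exact h x hx
    · exact (f.2.2 x hx).trans (g.2.2 x hx).symm

theorem SmoothFun.add_apply {a b : ℝ} (f g : SmoothFun a b) (x : ℝ) : (f + g) x = f x + g x := rfl

theorem SmoothFun.smul_apply {a b : ℝ} (c : ℂ) (f : SmoothFun a b) (x : ℝ) :
    (c • f) x = c * f x := rfl

theorem SmoothFun.zero_apply {a b : ℝ} (x : ℝ) : (0 : SmoothFun a b) x = 0 := rfl

theorem SmoothFun.mk_apply {a b : ℝ} {f : ℝ → ℂ} (hf : ContDiffOn ℝ ∞ f (Ioo a b)) {x : ℝ}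
    (hx : x ∈ Ioo a b) : SmoothFun.mk f hf x = f x := indicator_of_mem hx f

theorem derivLin_apply {a b : ℝ} (f : SmoothFun a b) {x : ℝ} (hx : x ∈ Ioo a b) :
    derivLin a b f x = deriv f x := indicator_of_mem hx _

theorem SmoothFun.hasDerivAt {a b : ℝ} (f : SmoothFun a b) {x : ℝ} (hx : x ∈ Ioo a b) :
    HasDerivAt f (derivLin a b f x) x := by
  rw [derivLin_apply f hx]
  exact (f.differentiableAt hx).hasDerivAt

theorem derivLin_eq_of_hasDerivAt {a b : ℝ} {f g : SmoothFun a b}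
    (h : ∀ x ∈ Ioo a b, HasDerivAt f (g x) x) : derivLin a b f = g :=
  SmoothFun.ext' fun x hx => (f.hasDerivAt hx).unique (h x hx)

theorem SmoothFun.continuousOn_Icc (f : X) : ContinuousOn f (Icc (-Real.pi) Real.pi) :=
  f.contDiffOn.continuousOn.mono Icc_subset

theorem SmoothFun.intervalIntegrable (f : X) :
    IntervalIntegrable f volume (-Real.pi) Real.pi := by
  refine ContinuousOn.intervalIntegrable ?_
  rw [uIcc_of_le (by linarith [Real.pi_pos])]
  exact f.continuousOn_Icc

/-- Restriction of functions to the compact interval `[-π, π]`. -/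
def restrictIcc : X →ₗ[ℂ] C(Icc (-Real.pi) Real.pi, ℂ) where
  toFun f := (toContinuous _ _ f).comp ⟨inclusion Icc_subset, continuous_inclusion _⟩
  map_add' _ _ := rfl
  map_smul' _ _ := rfl

theorem continuous_toContinuous {a b : ℝ} (k : ℕ) :
    Continuous fun f : SmoothFun a b => toContinuous a b ((derivLin a b ^ k) f) :=
  continuous_iInf_dom (i := k) continuous_induced_dom

theorem continuous_derivLin {a b : ℝ} : Continuous (derivLin a b) := (D a b).continuous

theorem continuous_restrictIcc : Continuous restrictIcc :=
  (ContinuousMap.continuous_precomp _).comp (continuous_toContinuous 0)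

theorem norm_apply_le (f : X) {x : ℝ} (hx : x ∈ Icc (-Real.pi) Real.pi) :
    ‖f x‖ ≤ ‖restrictIcc f‖ :=
  (restrictIcc f).norm_coe_le_norm ⟨x, hx⟩

/-- The `C¹` norm on `[-π, π]`. -/
def normC1 (f : X) : ℝ := ‖restrictIcc f‖ + ‖restrictIcc (dX f)‖

theorem continuous_normC1 : Continuous normC1 :=
  continuous_restrictIcc.norm.add (continuous_restrictIcc.comp continuous_derivLin).norm

theorem continuous_of_le_normC1 (T : X →ₗ[ℂ] ℂ) {C : ℝ} (h : ∀ f, ‖T f‖ ≤ C * normC1 f) :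
    Continuous T := by
  refine continuous_of_continuousAt_zero T ?_
  rw [ContinuousAt, map_zero]
  refine squeeze_zero_norm h ?_
  have := (continuous_normC1.tendsto 0).const_mul C
  simpa [normC1] using this

/-- The (unnormalised) Fourier coefficient `∫_{-π}^{π} f(x) e^{-inx} dx`. -/
def coeff (n : ℤ) : X →ₗ[ℂ] ℂ where
  toFun f := ∫ x in (-Real.pi)..Real.pi, Complex.exp (-(n * Complex.I * x)) * f x
  map_add' f g := by
    rw [← intervalIntegral.integral_add]
    · simp only [SmoothFun.add_apply, mul_add]
    · exact f.intervalIntegrable.continuousOn_mul (by fun_prop)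
    · exact g.intervalIntegrable.continuousOn_mul (by fun_prop)
  map_smul' c f := by
    rw [RingHom.id_apply, smul_eq_mul, ← intervalIntegral.integral_const_mul]
    refine intervalIntegral.integral_congr fun x _ => ?_
    simp only [SmoothFun.smul_apply]
    ring

theorem coeff_apply (n : ℤ) (f : X) :
    coeff n f = ∫ x in (-Real.pi)..Real.pi, Complex.exp (-(n * Complex.I * x)) * f x := rfl

/-- The jump `f(π) - f(-π)` of the `2π`-periodic extension of `f|_(-π, π)`. -/
def jump (f : X) : ℂ := f Real.pi - f (-Real.pi)

theorem norm_exp_I (n : ℤ) (x : ℝ) : ‖Complex.exp (-(n * Complex.I * x))‖ = 1 := by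
  rw [Complex.norm_exp]; simp

theorem norm_coeff_le (n : ℤ) (f : X) : ‖coeff n f‖ ≤ 2 * Real.pi * ‖restrictIcc f‖ := by
  rw [coeff_apply]
  refine (intervalIntegral.norm_integral_le_of_norm_le_const (C := ‖restrictIcc f‖)
    fun x hx => ?_).trans (le_of_eq ?_)
  · rw [uIoc_of_le (by linarith [Real.pi_pos])] at hx
    rw [norm_mul, norm_exp_I, one_mul]
    exact norm_apply_le f (Ioc_subset_Icc_self hx)
  · rw [abs_of_nonneg (by linarith [Real.pi_pos])]; ring

theorem exp_pi_I (n : ℤ) : Complex.exp (-(n * Complex.I * Real.pi)) = (-1) ^ n := by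
  rw [← Complex.exp_pi_mul_I, ← Complex.exp_int_mul, ← inv_inj, ← Complex.exp_neg,
    ← Complex.exp_neg, neg_neg]
  refine Complex.exp_eq_exp_iff_exists_int.2 ⟨n, by ring⟩

/-- Integration by parts. -/
theorem coeff_derivLin (n : ℤ) (f : X) :
    coeff n (dX f) = (-1) ^ n * jump f + n * Complex.I * coeff n f := by
  have hpi := Real.pi_pos
  have hu : ∀ x ∈ uIcc (-Real.pi) Real.pi, HasDerivAt
      (fun x : ℝ => Complex.exp (-(n * Complex.I * x)))
      (-(n * Complex.I) * Complex.exp (-(n * Complex.I * x))) x := fun x _ => by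
    have h1 : HasDerivAt (fun x : ℝ => -(n * Complex.I * (x : ℂ))) (-(n * Complex.I)) x := by
      simpa using ((hasDerivAt_id x).ofReal_comp.const_mul (n * Complex.I)).fun_neg
    simpa [mul_comm] using h1.cexp
  have hv : ∀ x ∈ uIcc (-Real.pi) Real.pi, HasDerivAt f (dX f x) x := fun x hx => by
    rw [uIcc_of_le (by linarith)] at hx
    exact f.hasDerivAt (Icc_subset hx)
  have h := intervalIntegral.integral_mul_deriv_eq_deriv_mul hu hv
    (Continuous.intervalIntegrable (by fun_prop) _ _) (dX f).intervalIntegrable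
  rw [coeff_apply, h, exp_pi_I]
  have e : Complex.exp (-(n * Complex.I * ((-Real.pi : ℝ) : ℂ))) = (-1) ^ n := by
    rw [← inv_inj, ← Complex.exp_neg]
    have := exp_pi_I n
    rw [show - -(n * Complex.I * ((-Real.pi : ℝ) : ℂ)) = -(n * Complex.I * Real.pi) by
      push_cast; ring, this, ← inv_zpow]
    norm_num
  rw [e]
  simp only [mul_assoc (-((n : ℂ) * Complex.I))]
  rw [intervalIntegral.integral_const_mul, ← coeff_apply, jump]
  ring

/-- Integration by parts makes the coefficient of index `n` of order `1 / n`; along the squares this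
is summable. -/
theorem norm_coeff_sq_le (k : ℤ) (f : X) :
    ‖coeff (k ^ 2) f‖ ≤ (4 * Real.pi + 2) * normC1 f * (1 / (1 + (k : ℝ) ^ 2)) := by
  have hpi := Real.pi_pos
  have h0 := norm_coeff_le (k ^ 2) f
  have h1 := norm_coeff_le (k ^ 2) (dX f)
  have h2 : (k : ℝ) ^ 2 * ‖coeff (k ^ 2) f‖ ≤
      2 * ‖restrictIcc f‖ + 2 * Real.pi * ‖restrictIcc (dX f)‖ := by
    have e : ((k ^ 2 : ℤ) : ℂ) * Complex.I * coeff (k ^ 2) f =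
        coeff (k ^ 2) (dX f) - (-1) ^ (k ^ 2) * jump f := by
      rw [coeff_derivLin]; ring
    have e' := congrArg norm e
    rw [norm_mul, norm_mul, Complex.norm_I, mul_one] at e'
    have e'' : ‖((k ^ 2 : ℤ) : ℂ)‖ = (k : ℝ) ^ 2 := by
      rw [Complex.norm_intCast]; push_cast; simp
    rw [e''] at e'
    rw [e']
    have hj : ‖(-1 : ℂ) ^ (k ^ 2) * jump f‖ ≤ 2 * ‖restrictIcc f‖ := by
      rw [norm_mul, norm_zpow, norm_neg, norm_one, one_zpow, one_mul, jump]
      refine (norm_sub_le _ _).trans ?_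
      have a1 := norm_apply_le f (x := Real.pi) ⟨by linarith, le_rfl⟩
      have a2 := norm_apply_le f (x := -Real.pi) ⟨le_rfl, by linarith⟩
      linarith
    exact (norm_sub_le _ _).trans (by linarith)
  rw [mul_one_div, le_div_iff₀ (by positivity), normC1]
  nlinarith [norm_nonneg (restrictIcc f), norm_nonneg (restrictIcc (dX f))]

theorem summable_norm_coeff_sq (f : X) : Summable fun k : ℤ => ‖coeff (k ^ 2) f‖ :=
  (summable_inv_one_add_sq.mul_left _).of_nonneg_of_le (fun _ => norm_nonneg _)
    fun k => norm_coeff_sq_le k f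

theorem summable_coeff_sq (f : X) : Summable fun k : ℤ => coeff (k ^ 2) f :=
  (summable_norm_coeff_sq f).of_norm

/-- The functional `f ↦ ∑ ∫_{-π}^{π} f(x) e^{-ik²x} dx`, the sum being over all integers `k`, i.e.
the pairing of `f` with the restriction to `[-π, π]` of the boundary values
`∑ exp(-ik²x)` of the theta function. -/
def theta : X →ₗ[ℂ] ℂ where
  toFun f := ∑' k : ℤ, coeff (k ^ 2) f
  map_add' f g := by
    simp only [map_add]
    exact (summable_coeff_sq f).tsum_add (summable_coeff_sq g)
  map_smul' c f := by
    simp only [map_smul, smul_eq_mul, RingHom.id_apply]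
    exact tsum_mul_left

theorem theta_apply (f : X) : theta f = ∑' k : ℤ, coeff (k ^ 2) f := rfl

theorem continuous_coeff (n : ℤ) : Continuous (coeff n) := by
  refine continuous_of_le_normC1 _ (C := 2 * Real.pi) fun f => (norm_coeff_le n f).trans ?_
  have := Real.pi_pos
  rw [normC1]
  gcongr
  exact le_add_of_nonneg_right (norm_nonneg _)

theorem continuous_theta : Continuous theta := by
  refine continuous_of_le_normC1 _
    (C := (4 * Real.pi + 2) * ∑' k : ℤ, 1 / (1 + (k : ℝ) ^ 2)) fun f => ?_
  refine tsum_of_norm_bounded (f := fun k : ℤ => coeff (k ^ 2) f) ?_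
    fun k => norm_coeff_sq_le k f
  have := summable_inv_one_add_sq.hasSum.mul_left ((4 * Real.pi + 2) * normC1 f)
  rwa [mul_right_comm] at this

theorem continuous_derivLin_pow {a b : ℝ} (j : ℕ) : Continuous (derivLin a b ^ j) := by
  induction j with
  | zero => exact continuous_id
  | succ j ih =>
    rw [pow_succ]
    exact ih.comp continuous_derivLin

/-- The subspace annihilated by the functional `theta` and all its derivatives. -/
def thetaSpace : Submodule ℂ X := ⨅ j : ℕ, LinearMap.ker (theta ∘ₗ dX ^ j)

theorem mem_thetaSpace {f : X} : f ∈ thetaSpace ↔ ∀ j : ℕ, theta ((dX ^ j) f) = 0 := by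
  simp [thetaSpace]

theorem theta_eq_zero {f : X} (hf : f ∈ thetaSpace) : theta f = 0 := mem_thetaSpace.1 hf 0

theorem isInvariant_thetaSpace : IsInvariantSubspace thetaSpace where
  isClosed := by
    have : (thetaSpace : Set X) = ⋂ j : ℕ, {f | theta ((dX ^ j) f) = 0} := by
      ext f; simp [mem_thetaSpace]
    rw [this]
    exact isClosed_iInter fun j =>
      isClosed_eq (continuous_theta.comp (continuous_derivLin_pow j)) continuous_const
  map_mem f hf := mem_thetaSpace.2 fun j => by
    have := mem_thetaSpace.1 hf (j + 1)
    rwa [pow_succ] at this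

theorem derivLin_mem {f : X} (hf : f ∈ thetaSpace) : dX f ∈ thetaSpace :=
  isInvariant_thetaSpace.map_mem f hf

/-- If `g` is an eigenvector of `d/dx` modulo `thetaSpace`, then the single condition `theta g = 0`
already puts `g` into `thetaSpace`, by induction on the order of the derivative. -/
theorem mem_thetaSpace_of_theta {g : X} {z : ℂ} (h : dX g - z • g ∈ thetaSpace)
    (h0 : theta g = 0) : g ∈ thetaSpace := by
  refine mem_thetaSpace.2 fun j => ?_
  induction j with
  | zero => exact h0
  | succ j ih =>
    have := mem_thetaSpace.1 h j
    rw [map_sub, map_smul, map_sub, map_smul, ih, smul_zero, sub_zero] at this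
    rwa [pow_succ]

/-! ### Exponentials and first-order equations -/

/-- The exponential `x ↦ e^{zx}`. -/
abbrev expo (z : ℂ) : X := monomialExp (-2 * Real.pi) (2 * Real.pi) 0 z

theorem zero_mem_Ioo : (0 : ℝ) ∈ Ioo (-2 * Real.pi) (2 * Real.pi) :=
  Icc_subset ⟨by linarith [Real.pi_pos], Real.pi_pos.le⟩

theorem monomialExp_apply (n : ℕ) (z : ℂ) {x : ℝ} (hx : x ∈ Ioo (-2 * Real.pi) (2 * Real.pi)) :
    monomialExp (-2 * Real.pi) (2 * Real.pi) n z x = (x : ℂ) ^ n * Complex.exp (z * x) :=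
  SmoothFun.mk_apply _ hx

theorem expo_apply (z : ℂ) {x : ℝ} (hx : x ∈ Ioo (-2 * Real.pi) (2 * Real.pi)) :
    expo z x = Complex.exp (z * x) := by
  simp [monomialExp_apply 0 z hx]

theorem hasDerivAt_cexp_mul (z : ℂ) (x : ℝ) :
    HasDerivAt (fun x : ℝ => Complex.exp (z * x)) (z * Complex.exp (z * x)) x := by
  have h1 : HasDerivAt (fun x : ℝ => z * (x : ℂ)) z x := by
    simpa using (hasDerivAt_id x).ofReal_comp.const_mul z
  simpa [mul_comm] using h1.cexp

theorem SmoothFun.hasDerivAt_of_eqOn {a b : ℝ} {f : SmoothFun a b} {g : ℝ → ℂ} {g' : ℂ} {x : ℝ}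
    (hx : x ∈ Ioo a b) (h : ∀ y ∈ Ioo a b, f y = g y) (hg : HasDerivAt g g' x) :
    HasDerivAt f g' x :=
  hg.congr_of_eventuallyEq (eventually_of_mem (isOpen_Ioo.mem_nhds hx) h)

theorem derivLin_expo (z : ℂ) : dX (expo z) = z • expo z := by
  refine derivLin_eq_of_hasDerivAt fun x hx => ?_
  rw [SmoothFun.smul_apply, expo_apply z hx]
  exact SmoothFun.hasDerivAt_of_eqOn hx (fun y hy => expo_apply z hy) (hasDerivAt_cexp_mul z x)

theorem derivLin_monomialExp_succ (n : ℕ) (z : ℂ) :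
    dX (monomialExp _ _ (n + 1) z) - z • monomialExp _ _ (n + 1) z =
      ((n : ℂ) + 1) • monomialExp _ _ n z := by
  rw [sub_eq_iff_eq_add]
  refine derivLin_eq_of_hasDerivAt fun x hx => ?_
  rw [SmoothFun.add_apply, SmoothFun.smul_apply, SmoothFun.smul_apply, monomialExp_apply _ z hx,
    monomialExp_apply _ z hx]
  refine SmoothFun.hasDerivAt_of_eqOn hx (fun y hy => monomialExp_apply (n + 1) z hy) ?_
  have h1 : HasDerivAt (fun x : ℝ => (x : ℂ) ^ (n + 1)) (((n : ℂ) + 1) * (x : ℂ) ^ n) x := by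
    simpa using (hasDerivAt_id x).ofReal_comp.fun_pow (n + 1)
  refine (h1.mul (hasDerivAt_cexp_mul z x)).congr_deriv ?_
  ring

theorem expo_ne_zero (z : ℂ) : expo z ≠ 0 := fun h => by
  have h1 : expo z 0 = 0 := by rw [h]; rfl
  rw [expo_apply z zero_mem_Ioo] at h1
  exact Complex.exp_ne_zero _ h1

theorem eq_smul_expo {g : X} {z : ℂ} (h : dX g = z • g) : g = g 0 • expo z := by
  have hd : ∀ x ∈ Ioo (-2 * Real.pi) (2 * Real.pi),
      HasDerivAt (fun x : ℝ => Complex.exp (-z * x) * g x) 0 x := fun x hx => by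
    have h1 := g.hasDerivAt hx
    rw [h, SmoothFun.smul_apply] at h1
    refine ((hasDerivAt_cexp_mul (-z) x).mul h1).congr_deriv ?_
    ring
  refine SmoothFun.ext' fun x hx => ?_
  have hc := isOpen_Ioo.is_const_of_deriv_eq_zero isPreconnected_Ioo
    (fun x hx => (hd x hx).differentiableAt.differentiableWithinAt)
    (fun x hx => (hd x hx).deriv) hx zero_mem_Ioo
  rw [SmoothFun.smul_apply, expo_apply z hx]
  have h2 : Complex.exp (z * x) * (Complex.exp (-z * x) * g x) = g x := by
    rw [← mul_assoc, ← Complex.exp_add]; simp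
  rw [← h2, hc]
  simp [mul_comm]

theorem derivLin_pow_expo (z : ℂ) (j : ℕ) : (dX ^ j) (expo z) = z ^ j • expo z := by
  induction j with
  | zero => simp
  | succ j ih =>
    rw [pow_succ, Module.End.mul_apply, derivLin_expo, map_smul, ih, smul_smul, pow_succ']

theorem expo_mem_iff {z : ℂ} : expo z ∈ thetaSpace ↔ theta (expo z) = 0 := by
  refine ⟨theta_eq_zero, fun h => mem_thetaSpace.2 fun j => ?_⟩
  rw [derivLin_pow_expo, map_smul, h, smul_zero]

/-- The Fourier coefficients of a solution `g` of `g' - z g = f`. -/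
theorem coeff_of_resolvent {f g : X} {z : ℂ} (h : dX g - z • g = f) (n : ℤ) :
    (z - n * Complex.I) * coeff n g = (-1) ^ n * jump g - coeff n f := by
  have h1 := coeff_derivLin n g
  rw [sub_eq_iff_eq_add.1 h, map_add, map_smul, smul_eq_mul] at h1
  linear_combination h1

theorem jump_expo (z : ℂ) :
    jump (expo z) = Complex.exp (z * Real.pi) - Complex.exp (-(z * Real.pi)) := by
  have := Real.pi_pos
  rw [jump, expo_apply z (Icc_subset ⟨by linarith, le_rfl⟩),
    expo_apply z (Icc_subset ⟨le_rfl, by linarith⟩)]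
  push_cast
  simp

theorem jump_expo_eq_zero_iff {z : ℂ} : jump (expo z) = 0 ↔ ∃ n : ℤ, z = n * Complex.I := by
  have hpi : (Real.pi : ℂ) ≠ 0 := by exact_mod_cast Real.pi_ne_zero
  rw [jump_expo, sub_eq_zero, Complex.exp_eq_exp_iff_exists_int]
  refine exists_congr fun n => ⟨fun h => ?_, fun h => ?_⟩
  · have : (2 * Real.pi : ℂ) * (z - n * Complex.I) = 0 := by linear_combination h
    have h2 : (2 * Real.pi : ℂ) ≠ 0 := by simp
    exact sub_eq_zero.1 ((mul_eq_zero.1 this).resolve_left h2)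
  · rw [h]; ring

theorem coeff_expo (n m : ℤ) :
    coeff n (expo (m * Complex.I)) = if n = m then (2 * Real.pi : ℂ) else 0 := by
  split_ifs with h
  · subst h
    rw [coeff_apply]
    have e : ∀ x ∈ uIcc (-Real.pi) Real.pi,
        Complex.exp (-(n * Complex.I * x)) * expo (n * Complex.I) x = 1 := fun x hx => by
      rw [uIcc_of_le (by linarith [Real.pi_pos])] at hx
      rw [expo_apply _ (Icc_subset hx), ← Complex.exp_add]
      simp
    rw [intervalIntegral.integral_congr e]
    simp; ring
  · have h1 := coeff_of_resolvent (f := 0) (g := expo (m * Complex.I)) (z := m * Complex.I)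
      (by rw [derivLin_expo, sub_self]) n
    rw [jump_expo_eq_zero_iff.2 ⟨m, rfl⟩, map_zero, mul_zero, sub_zero] at h1
    refine (mul_eq_zero.1 h1).resolve_left fun h2 => h ?_
    have h3 : ((m : ℂ) - n) * Complex.I = 0 := by linear_combination h2
    have h4 := (mul_eq_zero.1 h3).resolve_right Complex.I_ne_zero
    exact_mod_cast (sub_eq_zero.1 h4).symm

theorem theta_expo_sq (m : ℤ) :
    theta (expo ((m ^ 2 : ℤ) * Complex.I)) = if m = 0 then (2 * Real.pi : ℂ) else 4 * Real.pi := by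
  rw [theta_apply]
  simp only [coeff_expo]
  rw [tsum_eq_sum (s := {m, -m}) fun k hk => if_neg fun h => hk (by
    simpa using sq_eq_sq_iff_eq_or_eq_neg.1 h)]
  split_ifs with h
  · simp [h]
  · have : m ≠ -m := fun h' => h (by omega)
    rw [Finset.sum_pair this]
    simp
    ring

/-- The meromorphic function `∑ (-1)^k / (z - ik²)`. -/
def kernelSum (z : ℂ) : ℂ := ∑' k : ℤ, (-1 : ℂ) ^ k / (z - (k ^ 2 : ℤ) * Complex.I)

theorem kernelSum_eq {w : ℂ} (hw : w ∈ Complex.integerComplement) :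
    kernelSum (w ^ 2 * Complex.I) =
      -Complex.I * (Real.pi / (w * Complex.sin (Real.pi * w))) := by
  rw [← csc_series hw, ← tsum_mul_left, kernelSum]
  refine tsum_congr fun k => ?_
  have : w ^ 2 * Complex.I - (k ^ 2 : ℤ) * Complex.I = (w ^ 2 - (k : ℂ) ^ 2) * Complex.I := by
    push_cast; ring
  rw [this, div_mul_eq_div_div, Complex.div_I]
  ring

/-- Up to a constant factor the sum is a cosecant divided by its argument, so it has no zeros. -/
theorem kernelSum_ne_zero {z : ℂ} (hz : ∀ k : ℤ, z ≠ (k ^ 2 : ℤ) * Complex.I) :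
    kernelSum z ≠ 0 := by
  obtain ⟨w, hw⟩ := IsAlgClosed.exists_pow_nat_eq (-Complex.I * z) two_pos
  have hzw : z = w ^ 2 * Complex.I := by
    rw [hw]; linear_combination z * Complex.I_mul_I
  have hw' : w ∈ Complex.integerComplement := by
    rintro ⟨n, hn⟩
    refine hz n ?_
    rw [hzw, ← hn]; push_cast; ring
  have hw0 : w ≠ 0 := fun h => hw' ⟨0, by simp [h]⟩
  have hpi : (Real.pi : ℂ) ≠ 0 := by exact_mod_cast Real.pi_ne_zero
  have hs : Complex.sin (Real.pi * w) ≠ 0 := by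
    intro h
    obtain ⟨k, hk⟩ := Complex.sin_eq_zero_iff.1 h
    refine hw' ⟨k, ?_⟩
    have : (Real.pi : ℂ) * (k - w) = 0 := by rw [mul_sub, hk]; ring
    exact sub_eq_zero.1 ((mul_eq_zero.1 this).resolve_left hpi)
  rw [hzw, kernelSum_eq hw']
  simp [hw0, hs, hpi]

theorem summable_kernel (z : ℂ) :
    Summable fun k : ℤ => ‖(1 : ℂ) / (z - (k ^ 2 : ℤ) * Complex.I)‖ := by
  obtain ⟨N, hN⟩ := exists_nat_ge (2 * ‖z‖ + 1)
  refine Summable.of_norm_bounded_eventually (summable_inv_one_add_sq.mul_left 4) ?_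
  filter_upwards [(Set.finite_Icc (-(N : ℤ)) N).compl_mem_cofinite] with k hk
  have hk1 : (N : ℝ) < |(k : ℝ)| := by
    by_contra h
    rw [not_lt, abs_le] at h
    exact hk ⟨by exact_mod_cast h.1, by exact_mod_cast h.2⟩
  have hk2 : 2 * ‖z‖ + 1 ≤ (k : ℝ) ^ 2 := by
    have h0 := norm_nonneg z
    rw [← sq_abs]; nlinarith
  have h3 : (1 + (k : ℝ) ^ 2) / 4 ≤ ‖z - (k ^ 2 : ℤ) * Complex.I‖ := by
    have := norm_sub_norm_le (((k ^ 2 : ℤ) : ℂ) * Complex.I) z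
    rw [norm_sub_rev, norm_mul, Complex.norm_I, mul_one, Complex.norm_intCast] at this
    push_cast at this
    rw [abs_of_nonneg (by positivity)] at this
    push_cast
    linarith [sq_nonneg (k : ℝ)]
  rw [norm_norm, norm_div, norm_one]
  have : 4 * (1 / (1 + (k : ℝ) ^ 2)) = 1 / ((1 + (k : ℝ) ^ 2) / 4) := by field_simp
  rw [this]
  exact one_div_le_one_div_of_le (by positivity) h3

theorem summable_coeff_div (f : X) (z : ℂ) :
    Summable fun k : ℤ => coeff (k ^ 2) f / (z - (k ^ 2 : ℤ) * Complex.I) := by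
  refine ((summable_kernel z).mul_left (2 * Real.pi * ‖restrictIcc f‖)).of_norm_bounded fun k => ?_
  rw [div_eq_mul_one_div, norm_mul]
  exact mul_le_mul_of_nonneg_right (norm_coeff_le _ f) (norm_nonneg _)

/-- The value of `theta` on a solution `g` of `g' - z g = f`, obtained by summing
`coeff_of_resolvent` over the squares. -/
theorem theta_of_resolvent {f g : X} {z : ℂ} (hz : ∀ k : ℤ, z ≠ (k ^ 2 : ℤ) * Complex.I)
    (h : dX g - z • g = f) :
    theta g = jump g * kernelSum z - ∑' k : ℤ, coeff (k ^ 2) f / (z - (k ^ 2 : ℤ) * Complex.I) := by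
  have hsk : Summable fun k : ℤ => (-1 : ℂ) ^ k / (z - (k ^ 2 : ℤ) * Complex.I) := by
    refine (summable_kernel z).of_norm_bounded fun k => ?_
    rw [norm_div, norm_div, norm_zpow, norm_neg, norm_one, one_zpow]
  rw [kernelSum, ← tsum_mul_left, ← (hsk.mul_left _).tsum_sub (summable_coeff_div f z), theta_apply]
  refine tsum_congr fun k => ?_
  have h1 := coeff_of_resolvent h (k ^ 2)
  have hne : z - (k ^ 2 : ℤ) * Complex.I ≠ 0 := sub_ne_zero.2 (hz k)
  have hsign : (-1 : ℂ) ^ (k ^ 2) = (-1) ^ k := by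
    rcases Int.even_or_odd k with hk | hk
    · rw [hk.neg_one_zpow, (hk.pow_of_ne_zero two_ne_zero).neg_one_zpow]
    · rw [hk.neg_one_zpow, hk.pow.neg_one_zpow]
  rw [hsign] at h1
  rw [mul_div_assoc', ← sub_div, eq_div_iff hne]
  linear_combination h1

/-- The exponentials in `thetaSpace` are those whose frequency is an integer, but not a square. -/
theorem theta_expo_eq_zero_iff {z : ℂ} :
    theta (expo z) = 0 ↔ ∃ n : ℤ, z = n * Complex.I ∧ ∀ k : ℤ, n ≠ k ^ 2 := by
  have hpi : (Real.pi : ℂ) ≠ 0 := by exact_mod_cast Real.pi_ne_zero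
  by_cases hz : ∀ k : ℤ, z ≠ (k ^ 2 : ℤ) * Complex.I
  · have h := theta_of_resolvent (f := 0) (g := expo z) hz (by rw [derivLin_expo, sub_self])
    simp only [map_zero, zero_div, tsum_zero, sub_zero] at h
    rw [h, mul_eq_zero_iff_right (kernelSum_ne_zero hz), jump_expo_eq_zero_iff]
    refine exists_congr fun n => ⟨fun h => ⟨h, fun k hk => hz k ?_⟩, fun h => h.1⟩
    rw [h, hk]
  · push Not at hz
    obtain ⟨k, rfl⟩ := hz
    rw [theta_expo_sq]
    constructor
    · intro h; split_ifs at h <;> simp [hpi] at h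
    · rintro ⟨n, hn, hk⟩
      refine absurd ?_ (hk k)
      have := mul_right_cancel₀ Complex.I_ne_zero hn
      exact_mod_cast this.symm

/-- Every eigenvalue of `d/dx` on `thetaSpace` is semisimple. -/
theorem derivLin_sub_eq_zero {f : X} {z : ℂ} (hf : f ∈ thetaSpace)
    (h : dX (dX f - z • f) = z • (dX f - z • f)) : dX f - z • f = 0 := by
  set g := dX f - z • f with hg
  have hgL : g ∈ thetaSpace :=
    thetaSpace.sub_mem (derivLin_mem hf) (thetaSpace.smul_mem z hf)
  have hge := eq_smul_expo h
  by_contra hne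
  have hc : g 0 ≠ 0 := fun h0 => hne (by rw [hge, h0, zero_smul])
  have he : theta (expo z) = 0 := by
    have := theta_eq_zero hgL
    rw [hge, map_smul, smul_eq_mul] at this
    exact (mul_eq_zero.1 this).resolve_left hc
  obtain ⟨n, rfl, hn⟩ := theta_expo_eq_zero_iff.1 he
  have hz : ∀ k : ℤ, (n : ℂ) * Complex.I ≠ (k ^ 2 : ℤ) * Complex.I := fun k hk =>
    hn k (by exact_mod_cast mul_right_cancel₀ Complex.I_ne_zero hk)
  have h1 := theta_of_resolvent hz hg.symm
  have h2 : ∀ k : ℤ, coeff (k ^ 2) g = 0 := fun k => by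
    rw [hge, map_smul, coeff_expo, if_neg (hn k).symm, smul_zero]
  simp only [h2, zero_div, tsum_zero, sub_zero, theta_eq_zero hf] at h1
  have h3 := (mul_eq_zero.1 h1.symm).resolve_right (kernelSum_ne_zero hz)
  have h4 := coeff_of_resolvent hg.symm n
  rw [sub_self, zero_mul, h3, mul_zero, zero_sub, hge, map_smul, coeff_expo, if_pos rfl] at h4
  have hpi : (Real.pi : ℂ) ≠ 0 := by exact_mod_cast Real.pi_ne_zero
  simp [hc, hpi] at h4

theorem derivLin_sub_eq_zero_of_pow {f : X} {z : ℂ} (hf : f ∈ thetaSpace) (k : ℕ)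
    (h : ((dX - z • 1) ^ k) f = 0) : dX f - z • f = 0 := by
  have key : ∀ g : X, (dX - z • 1) g = dX g - z • g := fun g => rfl
  induction k generalizing f with
  | zero =>
    have : f = 0 := h
    simp [this]
  | succ k ih =>
    rw [pow_succ, Module.End.mul_apply, key] at h
    have := ih (thetaSpace.sub_mem (derivLin_mem hf) (thetaSpace.smul_mem z hf)) h
    exact derivLin_sub_eq_zero hf (sub_eq_zero.1 this)

/-! ### The resolvent, the spectrum and its density -/

theorem uIcc_zero_subset {x : ℝ} (hx : x ∈ Ioo (-2 * Real.pi) (2 * Real.pi)) :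
    uIcc 0 x ⊆ Ioo (-2 * Real.pi) (2 * Real.pi) :=
  ordConnected_Ioo.uIcc_subset zero_mem_Ioo hx

theorem intervalIntegrable_exp_mul (f : X) (z : ℂ) {x : ℝ}
    (hx : x ∈ Ioo (-2 * Real.pi) (2 * Real.pi)) :
    IntervalIntegrable (fun s : ℝ => Complex.exp (-z * s) * f s) volume 0 x :=
  ContinuousOn.intervalIntegrable <| ContinuousOn.mul (by fun_prop)
    (f.contDiffOn.continuousOn.mono (uIcc_zero_subset hx))

theorem hasDerivAt_primitive (f : X) (z : ℂ) {x : ℝ} (hx : x ∈ Ioo (-2 * Real.pi) (2 * Real.pi)) :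
    HasDerivAt (fun x : ℝ => ∫ s in (0 : ℝ)..x, Complex.exp (-z * s) * f s)
      (Complex.exp (-z * x) * f x) x := by
  have hc : ContinuousOn (fun s : ℝ => Complex.exp (-z * s) * f s)
      (Ioo (-2 * Real.pi) (2 * Real.pi)) :=
    ContinuousOn.mul (by fun_prop) f.contDiffOn.continuousOn
  exact intervalIntegral.integral_hasDerivAt_right (intervalIntegrable_exp_mul f z hx)
    (hc.stronglyMeasurableAtFilter isOpen_Ioo x hx)
    (hc.continuousAt (isOpen_Ioo.mem_nhds hx))

theorem contDiff_cexp_mul (z : ℂ) : ContDiff ℝ ∞ (fun x : ℝ => Complex.exp (z * x)) :=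
  (contDiff_const.mul Complex.ofRealCLM.contDiff).cexp

theorem contDiffOn_primitive (f : X) (z : ℂ) :
    ContDiffOn ℝ ∞ (fun x : ℝ => Complex.exp (z * x) *
      ∫ s in (0 : ℝ)..x, Complex.exp (-z * s) * f s) (Ioo (-2 * Real.pi) (2 * Real.pi)) := by
  refine (contDiff_cexp_mul z).contDiffOn.mul ?_
  refine (contDiffOn_infty_iff_deriv_of_isOpen isOpen_Ioo).2
    ⟨fun x hx => (hasDerivAt_primitive f z hx).differentiableAt.differentiableWithinAt, ?_⟩
  exact ((contDiff_cexp_mul (-z)).contDiffOn.mul f.contDiffOn).congr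
    fun x hx => (hasDerivAt_primitive f z hx).deriv

/-- The solution `x ↦ ∫_0^x e^{z(x - s)} f(s) ds` of `g' - z g = f`, `g(0) = 0`. -/
def solve (z : ℂ) : X →ₗ[ℂ] X where
  toFun f := SmoothFun.mk _ (contDiffOn_primitive f z)
  map_add' f g := SmoothFun.ext' fun x hx => by
    rw [SmoothFun.add_apply, SmoothFun.mk_apply _ hx, SmoothFun.mk_apply _ hx,
      SmoothFun.mk_apply _ hx, ← mul_add, ← intervalIntegral.integral_add
        (intervalIntegrable_exp_mul f z hx) (intervalIntegrable_exp_mul g z hx)]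
    simp only [SmoothFun.add_apply, mul_add]
  map_smul' c f := SmoothFun.ext' fun x hx => by
    rw [RingHom.id_apply, SmoothFun.smul_apply, SmoothFun.mk_apply _ hx, SmoothFun.mk_apply _ hx,
      mul_left_comm, ← intervalIntegral.integral_const_mul c]
    simp only [SmoothFun.smul_apply, mul_left_comm c]

theorem solve_apply (z : ℂ) (f : X) {x : ℝ} (hx : x ∈ Ioo (-2 * Real.pi) (2 * Real.pi)) :
    solve z f x = Complex.exp (z * x) * ∫ s in (0 : ℝ)..x, Complex.exp (-z * s) * f s :=
  SmoothFun.mk_apply (contDiffOn_primitive f z) hx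

theorem derivLin_solve (z : ℂ) (f : X) : dX (solve z f) = z • solve z f + f := by
  refine derivLin_eq_of_hasDerivAt fun x hx => ?_
  rw [SmoothFun.add_apply, SmoothFun.smul_apply, solve_apply z f hx]
  refine SmoothFun.hasDerivAt_of_eqOn hx (fun y hy => solve_apply z f hy) ?_
  refine ((hasDerivAt_cexp_mul z x).mul (hasDerivAt_primitive f z hx)).congr_deriv ?_
  have : Complex.exp (z * x) * (Complex.exp (-z * x) * f x) = f x := by
    rw [← mul_assoc, ← Complex.exp_add]; simp
  rw [this]; ring

theorem continuous_solve (z : ℂ) : Continuous (solve z) := by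
  refine continuous_iInf_rng.2 fun k => continuous_induced_rng.2 ?_
  induction k with
  | zero =>
    refine ContinuousMap.continuous_of_continuous_uncurry _ ?_
    have hmem : ∀ (x : Ioo (-2 * Real.pi) (2 * Real.pi)) (u : ℝ),
        (x : ℝ) * (projIcc (0 : ℝ) 1 zero_le_one u : ℝ) ∈ Ioo (-2 * Real.pi) (2 * Real.pi) := by
      intro x u
      have h := (projIcc (0 : ℝ) 1 zero_le_one u).2
      refine uIcc_zero_subset x.2 ?_
      rcases le_total (0 : ℝ) x with hx | hx
      · rw [uIcc_of_le hx]
        exact ⟨mul_nonneg hx h.1, mul_le_of_le_one_right hx h.2⟩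
      · rw [uIcc_of_ge hx]
        exact ⟨by nlinarith [h.1, h.2], mul_nonpos_of_nonpos_of_nonneg hx h.1⟩
    -- Rescale to an integral over `[0, 1]`, whose integrand is continuous in all variables.
    let G : X × Ioo (-2 * Real.pi) (2 * Real.pi) → ℝ → ℂ := fun p u =>
      Complex.exp (-z * ((p.2 : ℝ) * (projIcc (0 : ℝ) 1 zero_le_one u : ℝ) : ℝ)) *
        toContinuous _ _ p.1 ⟨_, hmem p.2 u⟩
    have hG : Continuous G.uncurry := by
      refine Continuous.mul ?_ ?_
      · have : Continuous fun q : (X × Ioo (-2 * Real.pi) (2 * Real.pi)) × ℝ =>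
            ((q.1.2 : ℝ) * (projIcc (0 : ℝ) 1 zero_le_one q.2 : ℝ) : ℝ) := by fun_prop
        fun_prop
      · have h1 : Continuous fun q : (X × Ioo (-2 * Real.pi) (2 * Real.pi)) × ℝ =>
            toContinuous _ _ q.1.1 :=
          (continuous_toContinuous 0).comp (continuous_fst.comp continuous_fst)
        have h2 : Continuous fun q : (X × Ioo (-2 * Real.pi) (2 * Real.pi)) × ℝ =>
            (⟨_, hmem q.1.2 q.2⟩ : Ioo (-2 * Real.pi) (2 * Real.pi)) :=
          Continuous.subtype_mk (by fun_prop) _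
        have : LocallyCompactSpace (Ioo (-2 * Real.pi) (2 * Real.pi)) :=
          isOpen_Ioo.locallyCompactSpace
        exact h1.eval h2
    have hI := intervalIntegral.continuous_parametric_intervalIntegral_of_continuous'
      (μ := volume) hG 0 1
    have hcont : Continuous fun p : X × Ioo (-2 * Real.pi) (2 * Real.pi) =>
        Complex.exp (z * (p.2 : ℝ)) * (((p.2 : ℝ) : ℂ) * ∫ u in (0 : ℝ)..1, G p u) := by
      fun_prop
    refine hcont.congr fun p => ?_
    have e : ∫ u in (0 : ℝ)..1, G p u = ∫ u in (0 : ℝ)..1,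
        (fun s : ℝ => Complex.exp (-z * s) * p.1 s) ((p.2 : ℝ) * u) := by
      refine intervalIntegral.integral_congr fun u hu => ?_
      rw [uIcc_of_le zero_le_one] at hu
      have h1 : (projIcc (0 : ℝ) 1 zero_le_one u : ℝ) = u := by
        rw [projIcc_of_mem zero_le_one hu]
      change Complex.exp (-z * ((p.2 : ℝ) * (projIcc (0 : ℝ) 1 zero_le_one u : ℝ) : ℝ)) *
        p.1 ((p.2 : ℝ) * (projIcc (0 : ℝ) 1 zero_le_one u : ℝ)) = _
      rw [h1]
    have h2 := intervalIntegral.smul_integral_comp_mul_left (a := (0 : ℝ)) (b := 1)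
      (fun s : ℝ => Complex.exp (-z * s) * p.1 s) (p.2 : ℝ)
    rw [mul_zero, mul_one, Complex.real_smul] at h2
    rw [e, h2]
    exact (solve_apply z p.1 p.2.2).symm
  | succ k ih =>
    have e : ∀ f : X, toContinuous _ _ ((dX ^ (k + 1)) (solve z f)) =
        z • toContinuous _ _ ((dX ^ k) (solve z f)) + toContinuous _ _ ((dX ^ k) f) := fun f => by
      rw [pow_succ, Module.End.mul_apply, derivLin_solve, map_add, map_add, map_smul, map_smul]
    exact ((ih.const_smul z).add (continuous_toContinuous k)).congr fun f => (e f).symm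

theorem solve_correction_mem {z : ℂ} (hz : theta (expo z) ≠ 0) {f : X} (hf : f ∈ thetaSpace) :
    solve z f - (theta (solve z f) / theta (expo z)) • expo z ∈ thetaSpace := by
  refine mem_thetaSpace_of_theta (z := z) ?_ ?_
  · rw [map_sub, map_smul, derivLin_solve, derivLin_expo, smul_sub, smul_comm z]
    convert hf using 1
    abel
  · rw [map_sub, map_smul, smul_eq_mul, div_mul_cancel₀ _ hz, sub_self]

/-- The resolvent of `d/dx` on `thetaSpace`. -/
def resolventOp {z : ℂ} (hz : theta (expo z) ≠ 0) : thetaSpace →L[ℂ] thetaSpace where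
  toFun f := ⟨solve z f - (theta (solve z f) / theta (expo z)) • expo z,
    solve_correction_mem hz f.2⟩
  map_add' f g := Subtype.ext <| by
    simp only [Submodule.coe_add, map_add, add_div, add_smul]
    abel
  map_smul' c f := Subtype.ext <| by
    simp only [Submodule.coe_smul, map_smul, RingHom.id_apply, smul_sub, smul_smul, smul_eq_mul,
      mul_div_assoc]
  cont := by
    have h : Continuous fun f : thetaSpace => solve z (f : X) :=
      (continuous_solve z).comp continuous_subtype_val
    have h' : Continuous fun f : thetaSpace => theta (solve z (f : X)) / theta (expo z) :=
      (continuous_theta.comp h).div_const _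
    exact Continuous.subtype_mk (h.sub (h'.smul continuous_const)) _

theorem coe_resolventOp {z : ℂ} (hz : theta (expo z) ≠ 0) (f : thetaSpace) :
    (resolventOp hz f : X) = solve z f - (theta (solve z f) / theta (expo z)) • expo z := rfl

theorem mem_spec_iff {z : ℂ} : z ∈ spec isInvariant_thetaSpace ↔ theta (expo z) = 0 := by
  have key : ∀ f : thetaSpace,
      (((algebraMap ℂ (thetaSpace →L[ℂ] thetaSpace) z - restrictD isInvariant_thetaSpace) f :
        thetaSpace) : X) = z • (f : X) - dX f := fun f => rfl
  rw [spec, spectrum.mem_iff]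
  constructor
  · intro h
    by_contra hz
    have hinj : ∀ f : thetaSpace,
        (algebraMap ℂ (thetaSpace →L[ℂ] thetaSpace) z - restrictD isInvariant_thetaSpace) f = 0 →
        f = 0 := fun f hf => by
      have h1 : z • (f : X) - dX f = 0 := by rw [← key, hf]; rfl
      have h2 := eq_smul_expo (sub_eq_zero.1 h1).symm
      have h3 := theta_eq_zero f.2
      rw [h2, map_smul, smul_eq_mul] at h3
      have h4 := (mul_eq_zero.1 h3).resolve_right hz
      exact Subtype.ext (by rw [h2, h4, zero_smul]; rfl)
    have hright : (algebraMap ℂ (thetaSpace →L[ℂ] thetaSpace) z -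
        restrictD isInvariant_thetaSpace) * (-resolventOp hz) = 1 := by
      refine ContinuousLinearMap.ext fun f => Subtype.ext ?_
      rw [mul_apply_eq_comp, key]
      change z • (-(resolventOp hz f : X)) - dX (-(resolventOp hz f : X)) = f
      rw [coe_resolventOp, map_neg, map_sub, map_smul, derivLin_solve, derivLin_expo, smul_neg,
        smul_sub, smul_comm z]
      abel
    refine h (isUnit_iff_exists.2 ⟨_, hright, ?_⟩)
    refine ContinuousLinearMap.ext fun f => sub_eq_zero.1 (hinj _ ?_)
    rw [map_sub, mul_apply_eq_comp, ← mul_apply_eq_comp, hright]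
    simp
  · intro hz hu
    obtain ⟨b, -, hb⟩ := isUnit_iff_exists.1 hu
    have h1 : (algebraMap ℂ (thetaSpace →L[ℂ] thetaSpace) z - restrictD isInvariant_thetaSpace)
        ⟨expo z, expo_mem_iff.2 hz⟩ = 0 :=
      Subtype.ext (by rw [key, derivLin_expo, sub_self]; rfl)
    have h2 := congrArg b h1
    rw [← mul_apply_eq_comp, hb, map_zero] at h2
    exact expo_ne_zero z (congrArg Subtype.val h2)

theorem mem_spec_iff' {z : ℂ} :
    z ∈ spec isInvariant_thetaSpace ↔ ∃ n : ℤ, z = n * Complex.I ∧ ∀ k : ℤ, n ≠ k ^ 2 :=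
  mem_spec_iff.trans theta_expo_eq_zero_iff

theorem neg_int_mem_spec {n : ℤ} (hn : n < 0) :
    (n : ℂ) * Complex.I ∈ spec isInvariant_thetaSpace :=
  mem_spec_iff'.2 ⟨n, rfl, fun k hk => by nlinarith [sq_nonneg k]⟩

theorem hasDiscreteSpectrum_thetaSpace : HasDiscreteSpectrum isInvariant_thetaSpace where
  nonempty := ⟨_, neg_int_mem_spec (n := -1) (by norm_num)⟩
  discrete z hz := by
    rw [accPt_iff_nhds] at hz
    obtain ⟨y, ⟨hy, hys⟩, hyz⟩ := hz _ (Metric.ball_mem_nhds z one_half_pos)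
    obtain ⟨y', ⟨hy', hys'⟩, hyz'⟩ := hz _ (Metric.ball_mem_nhds z
      (lt_min (one_half_pos (α := ℝ)) (dist_pos.2 hyz)))
    obtain ⟨n, rfl, -⟩ := mem_spec_iff'.1 hys
    obtain ⟨m, rfl, -⟩ := mem_spec_iff'.1 hys'
    rw [Metric.mem_ball] at hy hy'
    have h1 : dist ((n : ℂ) * Complex.I) (m * Complex.I) < 1 := by
      have := dist_triangle_right ((n : ℂ) * Complex.I) (m * Complex.I) z
      linarith [hy'.trans_le (min_le_left _ _)]
    rw [dist_eq_norm, ← sub_mul, norm_mul, Complex.norm_I, mul_one, ← Int.cast_sub,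
      Complex.norm_intCast] at h1
    have h2 : |n - m| < 1 := by exact_mod_cast h1
    rw [Int.abs_lt_one_iff, sub_eq_zero] at h2
    subst h2
    exact lt_irrefl _ (hy'.trans_le (min_le_right _ _))
  eigenvalue z hz := by
    have h := mem_spec_iff.1 hz
    refine Module.End.hasEigenvalue_of_hasEigenvector
      (x := ⟨expo z, expo_mem_iff.2 h⟩) ⟨?_, ?_⟩
    · rw [Module.End.mem_eigenspace_iff]
      exact Subtype.ext (derivLin_expo z)
    · exact fun h0 => expo_ne_zero z (congrArg Subtype.val h0)

theorem specMultiplicity_eq_one {z : ℂ} (hz : z ∈ spec isInvariant_thetaSpace) :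
    specMultiplicity isInvariant_thetaSpace z = 1 := by
  have h := mem_spec_iff.1 hz
  set T : Module.End ℂ thetaSpace := (restrictD isInvariant_thetaSpace : Module.End ℂ thetaSpace)
    with hT
  set e : thetaSpace := ⟨expo z, expo_mem_iff.2 h⟩ with he
  have hpow : ∀ (k : ℕ) (f : thetaSpace),
      ((((T - z • 1) ^ k) f : thetaSpace) : X) = ((dX - z • 1) ^ k) (f : X) := by
    intro k
    induction k with
    | zero => intro f; rfl
    | succ k ih =>
      intro f
      rw [pow_succ, pow_succ, Module.End.mul_apply, Module.End.mul_apply, ih]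
      rfl
  have hspan : Module.End.maxGenEigenspace T z = Submodule.span ℂ {e} := by
    refine le_antisymm (fun f hf => ?_) ?_
    · obtain ⟨k, hk⟩ := (Module.End.mem_maxGenEigenspace T z f).1 hf
      have h1 := hpow k f
      rw [hk] at h1
      have h2 := derivLin_sub_eq_zero_of_pow f.2 k h1.symm
      have h3 := eq_smul_expo (sub_eq_zero.1 h2)
      exact Submodule.mem_span_singleton.2 ⟨_, Subtype.ext h3.symm⟩
    · rw [Submodule.span_singleton_le_iff_mem, Module.End.mem_maxGenEigenspace]
      refine ⟨1, ?_⟩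
      rw [pow_one]
      exact Subtype.ext (sub_eq_zero.2 (derivLin_expo z))
  have hne : e ≠ 0 := fun h0 => expo_ne_zero z (congrArg Subtype.val h0)
  have hrank : Module.rank ℂ (Submodule.span ℂ {e}) = 1 := by
    rw [← Module.finrank_eq_rank, finrank_span_singleton hne, Nat.cast_one]
  rw [specMultiplicity, hspan, hrank, map_one]

theorem specCount_eq (x r : ℝ) : specCount isInvariant_thetaSpace x r =
    ({n : ℤ | (n : ℝ) ∈ Icc x (x + r) ∧ ∀ k : ℤ, n ≠ k ^ 2}.encard : ℝ≥0∞) := by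
  have h1 : specCount isInvariant_thetaSpace x r =
      ∑' _ : {z : ℂ // z ∈ spec isInvariant_thetaSpace ∧ z.im ∈ Icc x (x + r)}, 1 := by
    refine tsum_congr fun z => ?_
    rw [specMultiplicity_eq_one z.2.1, ENat.toENNReal_one]
  have h2 : {z : ℂ | z ∈ spec isInvariant_thetaSpace ∧ z.im ∈ Icc x (x + r)} =
      (fun n : ℤ => (n : ℂ) * Complex.I) ''
        {n : ℤ | (n : ℝ) ∈ Icc x (x + r) ∧ ∀ k : ℤ, n ≠ k ^ 2} := by
    ext z
    simp only [mem_ofPred_eq, mem_spec_iff', mem_image]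
    constructor
    · rintro ⟨⟨n, rfl, hn⟩, h⟩
      exact ⟨n, ⟨by simpa using h, hn⟩, rfl⟩
    · rintro ⟨n, ⟨h, hn⟩, rfl⟩
      exact ⟨⟨n, rfl, hn⟩, by simpa using h⟩
  have hinj : Function.Injective fun n : ℤ => (n : ℂ) * Complex.I := fun n m h => by
    exact_mod_cast mul_right_cancel₀ Complex.I_ne_zero h
  rw [h1]
  have h3 := ENNReal.tsum_set_one {z : ℂ | z ∈ spec isInvariant_thetaSpace ∧ z.im ∈ Icc x (x + r)}
  rw [h2, hinj.injOn.encard_image, ← h2] at h3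
  exact h3

theorem hasUpperDensity_thetaSpace : HasUpperDensity isInvariant_thetaSpace 1 := by
  have hupper : ∀ r : ℝ, 0 < r → ∀ x : ℝ,
      specCount isInvariant_thetaSpace x r ≤ ENNReal.ofReal (r + 1) := by
    intro r hr x
    have hsub : {n : ℤ | (n : ℝ) ∈ Icc x (x + r) ∧ ∀ k : ℤ, n ≠ k ^ 2} ⊆
        ((Finset.Icc ⌈x⌉ ⌊x + r⌋ : Finset ℤ) : Set ℤ) := by
      rintro n ⟨⟨h1, h2⟩, -⟩
      rw [Finset.coe_Icc]
      exact ⟨Int.ceil_le.2 h1, Int.le_floor.2 h2⟩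
    have h1 := encard_le_encard hsub
    rw [Set.encard_coe_eq_coe_finsetCard, Int.card_Icc] at h1
    rw [specCount_eq]
    refine (ENat.toENNReal_mono h1).trans ?_
    rw [ENat.toENNReal_coe, ← ENNReal.ofReal_natCast]
    refine ENNReal.ofReal_le_ofReal ?_
    have h2 : ((⌊x + r⌋ + 1 - ⌈x⌉ : ℤ) : ℝ) ≤ r + 1 := by
      push_cast
      linarith [Int.floor_le (x + r), Int.le_ceil x]
    have h3 : (((⌊x + r⌋ + 1 - ⌈x⌉).toNat : ℤ) : ℝ) ≤ max (r + 1) 0 := by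
      rw [Int.toNat_eq_max]
      push_cast
      push_cast at h2
      exact max_le_max h2 le_rfl
    rw [max_eq_left (by linarith)] at h3
    exact_mod_cast h3
  -- The interval `[-r-1, -1]` contains no squares.
  have hlower : ∀ r : ℝ, 0 < r →
      ENNReal.ofReal r ≤ specCount isInvariant_thetaSpace (-r - 1) r := by
    intro r hr
    have hsub : ((Finset.Icc (-⌊r⌋ - 1) (-1) : Finset ℤ) : Set ℤ) ⊆
        {n : ℤ | (n : ℝ) ∈ Icc (-r - 1) (-r - 1 + r) ∧ ∀ k : ℤ, n ≠ k ^ 2} := by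
      intro n hn
      rw [Finset.coe_Icc] at hn
      have h1 : ((-⌊r⌋ - 1 : ℤ) : ℝ) ≤ n := by exact_mod_cast hn.1
      have h2 : (n : ℝ) ≤ -1 := by exact_mod_cast hn.2
      push_cast at h1
      refine ⟨⟨by linarith [Int.floor_le r], by linarith⟩, fun k hk => ?_⟩
      nlinarith [sq_nonneg k, hn.2]
    have h1 := encard_le_encard hsub
    rw [Set.encard_coe_eq_coe_finsetCard, Int.card_Icc] at h1
    rw [specCount_eq]
    refine le_trans ?_ (ENat.toENNReal_mono h1)
    rw [ENat.toENNReal_coe, ← ENNReal.ofReal_natCast]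
    refine ENNReal.ofReal_le_ofReal ?_
    have h2 : r ≤ ((-1 + 1 - (-⌊r⌋ - 1) : ℤ) : ℝ) := by
      push_cast
      linarith [Int.lt_floor_add_one r]
    refine h2.trans ?_
    exact_mod_cast Int.self_le_toNat _
  have hlim : Tendsto (fun r : ℝ => ENNReal.ofReal ((r + 1) / r)) atTop (𝓝 1) := by
    have h1 : Tendsto (fun r : ℝ => 1 + r⁻¹) atTop (𝓝 (1 + 0)) :=
      tendsto_inv_atTop_zero.const_add 1
    have h2 : Tendsto (fun r : ℝ => (r + 1) / r) atTop (𝓝 1) := by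
      rw [add_zero] at h1
      refine h1.congr' ?_
      filter_upwards [eventually_gt_atTop 0] with r hr
      field_simp
    simpa using ENNReal.tendsto_ofReal h2
  refine tendsto_of_tendsto_of_tendsto_of_le_of_le' tendsto_const_nhds hlim ?_ ?_
  · filter_upwards [eventually_gt_atTop 0] with r hr
    have hr0 : ENNReal.ofReal r ≠ 0 := by simpa using hr
    rw [ENNReal.le_div_iff_mul_le (Or.inl hr0) (Or.inl ENNReal.ofReal_ne_top), one_mul]
    exact (hlower r hr).trans (le_iSup (fun x => specCount isInvariant_thetaSpace x r) _)
  · filter_upwards [eventually_gt_atTop 0] with r hr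
    rw [ENNReal.ofReal_div_of_pos hr]
    exact ENNReal.div_le_div_right (iSup_le (hupper r hr)) _

/-! ### The residual part -/

/-- The subspace of functions vanishing on `[-π, π]`. -/
def vanishing : Submodule ℂ X where
  carrier := {f | ∀ x ∈ Icc (-Real.pi) Real.pi, f x = 0}
  add_mem' {f g} hf hg x hx := by rw [SmoothFun.add_apply, hf x hx, hg x hx, add_zero]
  zero_mem' _ _ := rfl
  smul_mem' c f hf x hx := by rw [SmoothFun.smul_apply, hf x hx, mul_zero]

theorem mem_vanishing {f : X} : f ∈ vanishing ↔ ∀ x ∈ Icc (-Real.pi) Real.pi, f x = 0 := Iff.rfl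

theorem derivLin_mem_vanishing {f : X} (hf : f ∈ vanishing) : dX f ∈ vanishing := fun x hx => by
  have hu := uniqueDiffOn_Icc (show -Real.pi < Real.pi by linarith [Real.pi_pos]) x hx
  have h1 := (f.hasDerivAt (Icc_subset hx)).hasDerivWithinAt (s := Icc (-Real.pi) Real.pi)
  have h2 : HasDerivWithinAt f 0 (Icc (-Real.pi) Real.pi) x :=
    (hasDerivWithinAt_const x _ (0 : ℂ)).congr hf (hf x hx)
  exact hu.eq_deriv _ h1 h2

theorem coeff_eq_zero_of_mem_vanishing {f : X} (hf : f ∈ vanishing) (n : ℤ) : coeff n f = 0 := by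
  rw [coeff_apply]
  refine intervalIntegral.integral_zero_ae (Eventually.of_forall fun x hx => ?_)
  rw [uIoc_of_le (by linarith [Real.pi_pos])] at hx
  rw [hf x (Ioc_subset_Icc_self hx), mul_zero]

theorem vanishing_le_thetaSpace : vanishing ≤ thetaSpace := fun f hf => mem_thetaSpace.2 fun j => by
  have h : (dX ^ j) f ∈ vanishing := by
    induction j with
    | zero => exact hf
    | succ j ih =>
      rw [pow_succ', Module.End.mul_apply]
      exact derivLin_mem_vanishing ih
  rw [theta_apply]
  simp [coeff_eq_zero_of_mem_vanishing h]

theorem solve_mem_vanishing (z : ℂ) {f : X} (hf : f ∈ vanishing) : solve z f ∈ vanishing :=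
  fun x hx => by
    rw [solve_apply z f (Icc_subset hx)]
    have : ∫ s in (0 : ℝ)..x, Complex.exp (-z * s) * f s = 0 := by
      refine intervalIntegral.integral_zero_ae (Eventually.of_forall fun s hs => ?_)
      have h0 : (0 : ℝ) ∈ Icc (-Real.pi) Real.pi := ⟨by linarith [Real.pi_pos], Real.pi_pos.le⟩
      rw [hf s (ordConnected_Icc.uIcc_subset h0 hx (uIoc_subset_uIcc hs)), mul_zero]
    rw [this, mul_zero]

/-- Every nonzero polynomial in `d/dx` maps the functions vanishing on `[-π, π]` onto themselves. -/
theorem exists_aeval_eq {p : ℂ[X]} (hp : p ≠ 0) {f : X} (hf : f ∈ vanishing) :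
    ∃ g ∈ vanishing, Polynomial.aeval dX p g = f := by
  have key : ∀ (s : Multiset ℂ) (f : X), f ∈ vanishing → ∃ g ∈ vanishing,
      Polynomial.aeval dX (s.map fun z => Polynomial.X - Polynomial.C z).prod g = f := by
    intro s
    induction s using Multiset.induction_on with
    | empty => exact fun f hf => ⟨f, hf, by simp⟩
    | cons z s ih =>
      intro f hf
      obtain ⟨g, hg, hgf⟩ := ih _ (solve_mem_vanishing z hf)
      refine ⟨g, hg, ?_⟩
      rw [Multiset.map_cons, Multiset.prod_cons, map_mul, Module.End.mul_apply, hgf, map_sub,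
        Polynomial.aeval_X, Polynomial.aeval_C]
      change dX (solve z f) - z • solve z f = f
      rw [derivLin_solve, add_sub_cancel_left]
  obtain ⟨g, hg, hgf⟩ := key p.roots (p.leadingCoeff⁻¹ • f) (vanishing.smul_mem _ hf)
  refine ⟨g, hg, ?_⟩
  rw [(IsAlgClosed.splits p).eq_prod_roots, map_mul, Module.End.mul_apply, hgf,
    Polynomial.aeval_C]
  exact smul_inv_smul₀ (Polynomial.leadingCoeff_ne_zero.2 hp) f

theorem vanishing_le_residualPart : vanishing ≤ residualPart thetaSpace := by
  refine le_iInf₂ fun p hp f hf => ?_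
  obtain ⟨g, hg, hgf⟩ := exists_aeval_eq hp hf
  exact ⟨g, vanishing_le_thetaSpace hg, hgf⟩

theorem exists_of_mem_residualPart {f : X} (hf : f ∈ residualPart thetaSpace) (z : ℂ) :
    ∃ g ∈ thetaSpace, dX g - z • g = f := by
  have h := (Submodule.mem_iInf _).1 hf (Polynomial.X - Polynomial.C z)
  obtain ⟨g, hg, hgf⟩ := (Submodule.mem_iInf _).1 h (Polynomial.X_sub_C_ne_zero z)
  refine ⟨g, hg, ?_⟩
  rw [← hgf, map_sub, Polynomial.aeval_X, Polynomial.aeval_C]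
  rfl

theorem integral_cos_mul_cosh (k : ℤ) {m : ℝ} (hm : m ≠ 0) :
    ∫ t in (0 : ℝ)..Real.pi, Real.cos (k * t) * Real.cosh (m * (Real.pi - t)) =
      m * Real.sinh (m * Real.pi) / (m ^ 2 + k ^ 2) := by
  have hd : ∀ t : ℝ, HasDerivAt (fun t : ℝ =>
      (k * Real.sin (k * t) * Real.cosh (m * (Real.pi - t)) -
      m * Real.cos (k * t) * Real.sinh (m * (Real.pi - t))) / (m ^ 2 + k ^ 2))
      (Real.cos (k * t) * Real.cosh (m * (Real.pi - t))) t := fun t => by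
    have h1 : HasDerivAt (fun t : ℝ => (k : ℝ) * t) k t := by
      simpa using (hasDerivAt_id t).const_mul (k : ℝ)
    have h2 : HasDerivAt (fun t : ℝ => m * (Real.pi - t)) (-m) t := by
      simpa using ((hasDerivAt_id t).const_sub Real.pi).const_mul m
    refine (((((h1.sin).const_mul (k : ℝ)).mul h2.cosh).sub
      (((h1.cos).const_mul m).mul h2.sinh)).div_const _).congr_deriv ?_
    have : m ^ 2 + (k : ℝ) ^ 2 ≠ 0 := by positivity
    field_simp
    ring
  rw [intervalIntegral.integral_eq_sub_of_hasDerivAt (fun t _ => hd t)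
    (Continuous.intervalIntegrable (by fun_prop) _ _)]
  simp
  ring

theorem integral_cos_mul_cos {k n : ℤ} (h : k ^ 2 ≠ n ^ 2) :
    ∫ t in (0 : ℝ)..Real.pi, Real.cos (k * t) * Real.cos (n * t) = 0 := by
  have hne : (k : ℝ) ^ 2 - (n : ℝ) ^ 2 ≠ 0 := sub_ne_zero.2 (by exact_mod_cast h)
  have hd : ∀ t : ℝ, HasDerivAt (fun t : ℝ => (k * Real.sin (k * t) * Real.cos (n * t) -
      n * Real.cos (k * t) * Real.sin (n * t)) / ((k : ℝ) ^ 2 - (n : ℝ) ^ 2))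
      (Real.cos (k * t) * Real.cos (n * t)) t := fun t => by
    have h1 : ∀ k : ℤ, HasDerivAt (fun t : ℝ => (k : ℝ) * t) k t := fun k => by
      simpa using (hasDerivAt_id t).const_mul (k : ℝ)
    refine (((((h1 k).sin.const_mul (k : ℝ)).mul (h1 n).cos).sub
      (((h1 k).cos.const_mul (n : ℝ)).mul (h1 n).sin)).div_const _).congr_deriv ?_
    field_simp
    ring
  rw [intervalIntegral.integral_eq_sub_of_hasDerivAt (fun t _ => hd t)
    (Continuous.intervalIntegrable (by fun_prop) _ _)]
  simp [Real.sin_int_mul_pi]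

/-- The cosine series `∑ cₖ(f) cos (kt)` formed with the Fourier coefficients of `f` of square
index. -/
def cosSeries (f : X) (t : ℝ) : ℂ := ∑' k : ℤ, coeff (k ^ 2) f * (Real.cos (k * t) : ℂ)

theorem norm_coeff_mul_cos_le (f : X) (k : ℤ) (t : ℝ) :
    ‖coeff (k ^ 2) f * (Real.cos (k * t) : ℂ)‖ ≤ ‖coeff (k ^ 2) f‖ := by
  rw [norm_mul, Complex.norm_real]
  exact mul_le_of_le_one_right (norm_nonneg _) (Real.abs_cos_le_one _)

theorem continuous_cosSeries (f : X) : Continuous (cosSeries f) :=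
  continuous_tsum (fun k => by fun_prop) (summable_norm_coeff_sq f)
    fun k t => norm_coeff_mul_cos_le f k t

theorem norm_cosSeries_le (f : X) (t : ℝ) :
    ‖cosSeries f t‖ ≤ ∑' k : ℤ, ‖coeff (k ^ 2) f‖ :=
  tsum_of_norm_bounded (summable_norm_coeff_sq f).hasSum fun k => norm_coeff_mul_cos_le f k t

theorem hasSum_integral_cosSeries (f : X) {h : ℝ → ℝ} (hh : Continuous h) :
    HasSum (fun k : ℤ => coeff (k ^ 2) f *
      ((∫ t in (0 : ℝ)..Real.pi, Real.cos (k * t) * h t : ℝ) : ℂ))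
      (∫ t in (0 : ℝ)..Real.pi, cosSeries f t * (h t : ℂ)) := by
  let g : ℤ → C(ℝ, ℂ) := fun k =>
    ⟨fun t => coeff (k ^ 2) f * ((Real.cos (k * t) * h t : ℝ) : ℂ), by fun_prop⟩
  have hsum : Summable fun k =>
      ‖(g k).restrict (⟨uIcc 0 Real.pi, isCompact_uIcc⟩ : TopologicalSpace.Compacts ℝ)‖ := by
    obtain ⟨C, hC⟩ := (isCompact_uIcc (a := (0 : ℝ)) (b := Real.pi)).exists_bound_of_continuousOn
      hh.continuousOn
    refine Summable.of_nonneg_of_le (fun _ => norm_nonneg _) (fun k => ?_)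
      ((summable_norm_coeff_sq f).mul_right |C|)
    refine (ContinuousMap.norm_le _ (by positivity)).2 fun t => ?_
    change ‖coeff (k ^ 2) f * ((Real.cos (k * t) * h t : ℝ) : ℂ)‖ ≤ _
    have h1 := (hC t t.2).trans (le_abs_self C)
    rw [norm_mul, Complex.norm_real, norm_mul]
    refine mul_le_mul_of_nonneg_left ?_ (norm_nonneg _)
    exact (mul_le_of_le_one_left (norm_nonneg _) (Real.abs_cos_le_one _)).trans h1
  have hint := intervalIntegral.hasSum_intervalIntegral_of_summable_norm (a := 0) (b := Real.pi)
    hsum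
  have e1 : ∀ t : ℝ, ∑' k, g k t = cosSeries f t * (h t : ℂ) := fun t => by
    rw [cosSeries, ← tsum_mul_right]
    refine tsum_congr fun k => ?_
    change coeff (k ^ 2) f * ((Real.cos (k * t) * h t : ℝ) : ℂ) = _
    push_cast; ring
  simp only [e1] at hint
  refine hint.congr_fun ?_
  intro k
  change _ = ∫ t in (0 : ℝ)..Real.pi, coeff (k ^ 2) f * ((Real.cos (k * t) * h t : ℝ) : ℂ)
  rw [intervalIntegral.integral_const_mul, intervalIntegral.integral_ofReal]

theorem kernelSum_neg_sq {m : ℝ} (hm : 0 < m) :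
    kernelSum (-(m : ℂ) ^ 2 * Complex.I) =
      Complex.I * (Real.pi / (m * Real.sinh (m * Real.pi) : ℝ)) := by
  have hw : (m : ℂ) * Complex.I ∈ Complex.integerComplement := by
    rintro ⟨n, hn⟩
    have := congrArg Complex.im hn
    simp at this
    exact hm.ne this
  have h := kernelSum_eq hw
  have e : (Real.pi : ℂ) * (m * Complex.I) = (m * Real.pi : ℂ) * Complex.I := by ring
  rw [e, Complex.sin_mul_I, mul_pow, Complex.I_sq] at h
  have e2 : (m : ℂ) * Complex.I * (Complex.sinh (m * Real.pi) * Complex.I) =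
      -(m * Complex.sinh (m * Real.pi)) := by
    linear_combination ((m : ℂ) * Complex.sinh (m * Real.pi)) * Complex.I_mul_I
  rw [e2] at h
  convert h using 1
  · congr 1; ring
  · push_cast
    rw [div_neg]; ring

/-- For `f` in the residual part, the hyperbolic moments of the cosine series are bounded. -/
theorem norm_integral_cosSeries_cosh_le {f : X} (hf : f ∈ residualPart thetaSpace) {m : ℕ}
    (hm : m ≠ 0) :
    ‖∫ t in (0 : ℝ)..Real.pi, cosSeries f t * (Real.cosh (m * (Real.pi - t)) : ℂ)‖ ≤
      2 * Real.pi ^ 2 * ‖restrictIcc f‖ := by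
  have hpi := Real.pi_pos
  have hm0 : (0 : ℝ) < m := by positivity
  obtain ⟨g, hg, hgf⟩ := exists_of_mem_residualPart hf (-((m : ℝ) : ℂ) ^ 2 * Complex.I)
  have hz : ∀ k : ℤ, (-((m : ℝ) : ℂ) ^ 2 * Complex.I) ≠ (k ^ 2 : ℤ) * Complex.I := fun k hk => by
    have h1 : (-((m : ℝ) : ℂ) ^ 2) = (k ^ 2 : ℤ) := mul_right_cancel₀ Complex.I_ne_zero hk
    have h2 : (-(m : ℝ) ^ 2) = (k : ℝ) ^ 2 := by exact_mod_cast h1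
    nlinarith [sq_nonneg (k : ℝ)]
  have hS : 0 < Real.sinh (m * Real.pi) := Real.sinh_pos_iff.2 (by positivity)
  have h1 := theta_of_resolvent hz hgf
  rw [theta_eq_zero hg, kernelSum_neg_sq hm0] at h1
  have h2 := hasSum_integral_cosSeries f (h := fun t => Real.cosh (m * (Real.pi - t)))
    (by fun_prop)
  have h3 : ∫ t in (0 : ℝ)..Real.pi, cosSeries f t * (Real.cosh (m * (Real.pi - t)) : ℂ) =
      Real.pi * jump g := by
    rw [← h2.tsum_eq]
    have e : ∀ k : ℤ, coeff (k ^ 2) f * ((∫ t in (0 : ℝ)..Real.pi, Real.cos (k * t) *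
        Real.cosh (m * (Real.pi - t)) : ℝ) : ℂ) = (-Complex.I * (m * Real.sinh (m * Real.pi) : ℝ)) *
        (coeff (k ^ 2) f / (-((m : ℝ) : ℂ) ^ 2 * Complex.I - (k ^ 2 : ℤ) * Complex.I)) := by
      intro k
      rw [integral_cos_mul_cosh k hm0.ne']
      have e1 : (-((m : ℝ) : ℂ) ^ 2 * Complex.I - (k ^ 2 : ℤ) * Complex.I) =
          -((((m : ℝ) ^ 2 + (k : ℝ) ^ 2 : ℝ) : ℂ) * Complex.I) := by push_cast; ring
      have e2 : (((m : ℝ) ^ 2 + (k : ℝ) ^ 2 : ℝ) : ℂ) ≠ 0 := by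
        rw [Complex.ofReal_ne_zero]; positivity
      rw [e1, Complex.ofReal_div]
      have hI := Complex.I_ne_zero
      field_simp
    simp only [e]
    rw [tsum_mul_left, ← sub_eq_zero.1 h1.symm]
    have e3 : ((m * Real.sinh (m * Real.pi) : ℝ) : ℂ) ≠ 0 := by
      rw [Complex.ofReal_ne_zero]; positivity
    field_simp
    linear_combination (-jump g) * Complex.I_sq
  have h4 := coeff_of_resolvent hgf (-(m : ℤ) ^ 2)
  have e4 : (-((m : ℝ) : ℂ) ^ 2 * Complex.I - ((-(m : ℤ) ^ 2 : ℤ) : ℂ) * Complex.I) = 0 := by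
    push_cast; ring
  rw [e4, zero_mul] at h4
  have h5 := congrArg norm (sub_eq_zero.1 h4.symm)
  rw [norm_mul, norm_zpow, norm_neg, norm_one, one_zpow, one_mul] at h5
  rw [h3, norm_mul, Complex.norm_real, h5, Real.norm_of_nonneg hpi.le]
  calc Real.pi * ‖coeff (-(m : ℤ) ^ 2) f‖ ≤ Real.pi * (2 * Real.pi * ‖restrictIcc f‖) :=
        mul_le_mul_of_nonneg_left (norm_coeff_le _ f) hpi.le
    _ = _ := by ring

theorem cosSeries_eq_zero {f : X} (hf : f ∈ residualPart thetaSpace) :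
    ∀ t ∈ Ioo 0 Real.pi, cosSeries f t = 0 := by
  have hpi := Real.pi_pos
  set S := ∑' k : ℤ, ‖coeff (k ^ 2) f‖ with hS
  have hS0 : 0 ≤ S := tsum_nonneg fun _ => norm_nonneg _
  have hc : Continuous fun x => cosSeries f (Real.pi - x) :=
    (continuous_cosSeries f).comp (by fun_prop)
  -- `e ^ (m x)` is `2 cosh (m x)` up to the bounded function `e ^ (- m x)`.
  have hbound : ∀ m : ℕ,
      ‖∫ x in (0 : ℝ)..Real.pi, (Real.exp (m * x) : ℂ) * cosSeries f (Real.pi - x)‖ ≤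
       2 * (2 * Real.pi ^ 2 * ‖restrictIcc f‖) + S * Real.pi := by
    intro m
    have hneg : ‖∫ x in (0 : ℝ)..Real.pi, (Real.exp (-(m * x)) : ℂ) * cosSeries f (Real.pi - x)‖ ≤
        S * Real.pi := by
      refine (intervalIntegral.norm_integral_le_of_norm_le_const (C := S) fun x hx => ?_).trans
        (le_of_eq ?_)
      · rw [uIoc_of_le hpi.le] at hx
        rw [norm_mul, Complex.norm_real, Real.norm_of_nonneg (Real.exp_pos _).le]
        have h1 : Real.exp (-(m * x)) ≤ 1 :=
          Real.exp_le_one_iff.2 (neg_nonpos.2 (mul_nonneg (Nat.cast_nonneg _) hx.1.le))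
        exact (mul_le_of_le_one_left (norm_nonneg _) h1).trans (norm_cosSeries_le f _)
      · rw [sub_zero, abs_of_pos hpi]
    rcases eq_or_ne m 0 with rfl | hm
    · simp only [Nat.cast_zero, zero_mul, neg_zero] at hneg ⊢
      have : 0 ≤ 2 * (2 * Real.pi ^ 2 * ‖restrictIcc f‖) := by positivity
      linarith
    · have h1 := norm_integral_cosSeries_cosh_le hf hm
      have h2 := intervalIntegral.integral_comp_sub_left (a := 0) (b := Real.pi)
        (fun t => cosSeries f t * (Real.cosh (m * (Real.pi - t)) : ℂ)) Real.pi
      rw [sub_self, sub_zero] at h2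
      rw [← h2] at h1
      have h3 : ∫ x in (0 : ℝ)..Real.pi, (Real.exp (m * x) : ℂ) * cosSeries f (Real.pi - x) =
          2 * (∫ x in (0 : ℝ)..Real.pi, cosSeries f (Real.pi - x) *
            (Real.cosh (m * (Real.pi - (Real.pi - x))) : ℂ)) -
          ∫ x in (0 : ℝ)..Real.pi, (Real.exp (-(m * x)) : ℂ) * cosSeries f (Real.pi - x) := by
        rw [← intervalIntegral.integral_const_mul, ← intervalIntegral.integral_sub]
        · refine intervalIntegral.integral_congr fun x _ => ?_
          simp only [sub_sub_cancel]
          rw [Real.cosh_eq]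
          push_cast
          ring
        · exact Continuous.intervalIntegrable (by fun_prop) _ _
        · exact Continuous.intervalIntegrable (by fun_prop) _ _
      rw [h3]
      refine (norm_sub_le _ _).trans (add_le_add ?_ hneg)
      rw [norm_mul, Complex.norm_ofNat]
      linarith
  have h := eq_zero_of_exp_moments_bounded hc hbound
  intro t ht
  have := h (Real.pi - t) ⟨by linarith [ht.2], by linarith [ht.1]⟩
  simpa using this

theorem coeff_sq_eq_zero {f : X} (hf : f ∈ residualPart thetaSpace) (n : ℤ) :
    coeff (n ^ 2) f = 0 := by
  have hpi := Real.pi_pos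
  have h1 := hasSum_integral_cosSeries f (h := fun t => Real.cos (n * t)) (by fun_prop)
  have h0 : EqOn (cosSeries f) 0 (Icc 0 Real.pi) := by
    have h : EqOn (cosSeries f) 0 (Ioo 0 Real.pi) := fun t ht => cosSeries_eq_zero hf t ht
    simpa [closure_Ioo hpi.ne] using h.closure (continuous_cosSeries f) continuous_const
  have h2 : ∫ t in (0 : ℝ)..Real.pi, cosSeries f t * (Real.cos (n * t) : ℂ) = 0 := by
    refine intervalIntegral.integral_zero_ae (Eventually.of_forall fun t ht => ?_)
    rw [uIoc_of_le hpi.le] at ht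
    rw [h0 (Ioc_subset_Icc_self ht), Pi.zero_apply, zero_mul]
  rw [h2] at h1
  have hpos : 0 < ∫ t in (0 : ℝ)..Real.pi, Real.cos (n * t) * Real.cos (n * t) := by
    refine intervalIntegral.integral_pos hpi (by fun_prop) (fun t _ => mul_self_nonneg _)
      ⟨0, ⟨le_rfl, hpi.le⟩, by simp⟩
  have h3 := h1.tsum_eq
  rw [tsum_eq_sum (s := {n, -n}) fun k hk => by
    rw [integral_cos_mul_cos fun h => hk (by simpa using sq_eq_sq_iff_eq_or_eq_neg.1 h),
      Complex.ofReal_zero, mul_zero]] at h3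
  have h4 : ∀ k ∈ ({n, -n} : Finset ℤ), coeff (k ^ 2) f *
      ((∫ t in (0 : ℝ)..Real.pi, Real.cos (k * t) * Real.cos (n * t) : ℝ) : ℂ) =
      coeff (n ^ 2) f *
      ((∫ t in (0 : ℝ)..Real.pi, Real.cos (n * t) * Real.cos (n * t) : ℝ) : ℂ) := by
    intro k hk
    rcases (by simpa using hk : k = n ∨ k = -n) with rfl | rfl
    · rfl
    · simp only [even_two, Even.neg_pow, Int.cast_neg, neg_mul, Real.cos_neg]
  rw [Finset.sum_congr rfl h4, Finset.sum_const, smul_eq_zero, mul_eq_zero] at h3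
  rcases h3 with h3 | h3 | h3
  · simp at h3
  · exact h3
  · exact absurd (Complex.ofReal_eq_zero.1 h3) hpos.ne'

theorem coeff_eq_zero_of_mem_residualPart {f : X} (hf : f ∈ residualPart thetaSpace) (n : ℤ) :
    coeff n f = 0 := by
  by_cases hn : ∃ k : ℤ, n = k ^ 2
  · obtain ⟨k, rfl⟩ := hn
    exact coeff_sq_eq_zero hf k
  · push Not at hn
    obtain ⟨g, hg, hgf⟩ := exists_of_mem_residualPart hf (n * Complex.I)
    have hz : ∀ k : ℤ, (n : ℂ) * Complex.I ≠ (k ^ 2 : ℤ) * Complex.I := fun k hk =>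
      hn k (by exact_mod_cast mul_right_cancel₀ Complex.I_ne_zero hk)
    have h1 := theta_of_resolvent hz hgf
    simp only [coeff_sq_eq_zero hf, zero_div, tsum_zero, sub_zero, theta_eq_zero hg] at h1
    have h2 := (mul_eq_zero.1 h1.symm).resolve_right (kernelSum_ne_zero hz)
    have h3 := coeff_of_resolvent hgf n
    rw [sub_self, zero_mul, h2, mul_zero, zero_sub] at h3
    exact neg_eq_zero.1 h3.symm

/-- Uniqueness of Fourier coefficients. -/
theorem mem_vanishing_of_coeff_eq_zero {f : X} (hf : ∀ n : ℤ, coeff n f = 0) : f ∈ vanishing := by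
  have hpi := Real.pi_pos
  have hlt : -Real.pi < Real.pi := by linarith
  have hL2 : MemLp f 2 (volume.restrict (Ioc (-Real.pi) Real.pi)) :=
    MemLp.of_bound ((f.continuousOn_Icc.mono Ioc_subset_Icc_self).aestronglyMeasurable
      measurableSet_Ioc) ‖restrictIcc f‖ <| (ae_restrict_mem measurableSet_Ioc).mono
        fun x hx => norm_apply_le f (Ioc_subset_Icc_self hx)
  have h := hasSum_sq_fourierCoeffOn hlt hL2
  have h0 : ∀ n : ℤ, fourierCoeffOn hlt f n = 0 := fun n => by
    rw [fourierCoeffOn_eq_integral]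
    have e : ∫ x in (-Real.pi)..Real.pi,
        fourier (-n) (x : AddCircle (Real.pi - -Real.pi)) • f x = coeff n f := by
      rw [coeff_apply]
      refine intervalIntegral.integral_congr fun x _ => ?_
      simp only [fourier_coe_apply, smul_eq_mul]
      congr 2
      have : (Real.pi : ℂ) ≠ 0 := by exact_mod_cast hpi.ne'
      push_cast
      rw [sub_neg_eq_add, ← two_mul]
      field_simp
    rw [e, hf n, smul_zero]
  simp only [h0, norm_zero, ne_eq, OfNat.ofNat_ne_zero, not_false_eq_true, zero_pow] at h
  have h1 := h.unique hasSum_zero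
  have h2 : ∫ x in (-Real.pi)..Real.pi, ‖f x‖ ^ 2 = 0 := by
    refine (smul_eq_zero.1 h1).resolve_left (inv_ne_zero (by linarith))
  by_contra hne
  simp only [mem_vanishing, not_forall] at hne
  obtain ⟨x, hx, hfx⟩ := hne
  refine (intervalIntegral.integral_pos hlt (f.continuousOn_Icc.norm.pow 2)
    (fun _ _ => sq_nonneg _) ⟨x, hx, pow_pos (norm_pos_iff.2 hfx) 2⟩).ne' h2

theorem residualPart_thetaSpace : residualPart thetaSpace = vanishing :=
  le_antisymm (fun _ hf => mem_vanishing_of_coeff_eq_zero (coeff_eq_zero_of_mem_residualPart hf))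
    vanishing_le_residualPart

/-! ### A function outside the synthesizable part -/

/-- A family indexed by the integers decays faster than every power. -/
def IsRapid (a : ℤ → ℂ) : Prop := ∀ N : ℕ, Summable fun k : ℤ => |(k : ℝ)| ^ N * ‖a k‖

theorem IsRapid.summable_norm {a : ℤ → ℂ} (ha : IsRapid a) : Summable fun k => ‖a k‖ := by
  simpa using ha 0

/-- The coefficients of the derivative of `∑ aₖ exp (ik²x)`. -/
def sqMul (a : ℤ → ℂ) : ℤ → ℂ := fun k => (k ^ 2 : ℤ) * Complex.I * a k

theorem norm_sqMul (a : ℤ → ℂ) (k : ℤ) : ‖sqMul a k‖ = |(k : ℝ)| ^ 2 * ‖a k‖ := by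
  rw [sqMul, norm_mul, norm_mul, Complex.norm_I, mul_one, Complex.norm_intCast]
  push_cast
  rw [abs_pow]

theorem IsRapid.sqMul {a : ℤ → ℂ} (ha : IsRapid a) : IsRapid (sqMul a) := fun N => by
  simp only [norm_sqMul, ← mul_assoc, ← pow_add]
  exact ha (N + 2)

/-- The series `∑ aₖ exp (ik²x)`. -/
def sqSeries (a : ℤ → ℂ) (x : ℝ) : ℂ :=
  ∑' k : ℤ, a k * Complex.exp ((k ^ 2 : ℤ) * Complex.I * x)

theorem norm_cexp_int_mul_I (n : ℤ) (x : ℝ) : ‖Complex.exp (n * Complex.I * x)‖ = 1 := by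
  rw [Complex.norm_exp]; simp

theorem hasDerivAt_sqSeries {a : ℤ → ℂ} (ha : IsRapid a) (x : ℝ) :
    HasDerivAt (sqSeries a) (sqSeries (sqMul a) x) x := by
  refine hasDerivAt_tsum
    (g := fun (k : ℤ) (x : ℝ) => a k * Complex.exp ((k ^ 2 : ℤ) * Complex.I * x))
    (g' := fun (k : ℤ) (x : ℝ) => sqMul a k * Complex.exp ((k ^ 2 : ℤ) * Complex.I * x))
    (u := fun k => ‖sqMul a k‖) (y₀ := 0) ha.sqMul.summable_norm (fun k y => ?_)
    (fun k y => ?_) ?_ x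
  · refine ((hasDerivAt_cexp_mul _ y).const_mul (a k)).congr_deriv ?_
    rw [sqMul]; ring
  · rw [norm_mul, norm_cexp_int_mul_I, mul_one]
  · simpa using ha.summable_norm.of_norm

theorem contDiff_sqSeries {a : ℤ → ℂ} (ha : IsRapid a) : ContDiff ℝ ∞ (sqSeries a) := by
  refine contDiff_infty.2 fun n => ?_
  induction n generalizing a with
  | zero =>
    exact contDiff_zero.2 (continuous_iff_continuousAt.2 fun x =>
      (hasDerivAt_sqSeries ha x).continuousAt)
  | succ n ih =>
    have h : deriv (sqSeries a) = sqSeries (sqMul a) :=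
      funext fun x => (hasDerivAt_sqSeries ha x).deriv
    push_cast
    refine contDiff_succ_iff_deriv.2
      ⟨fun x => (hasDerivAt_sqSeries ha x).differentiableAt, by simp, ?_⟩
    rw [h]
    exact ih ha.sqMul

/-- The element `∑ aₖ exp (ik²x)` of `C^∞(-2π, 2π)`. -/
def sqFun {a : ℤ → ℂ} (ha : IsRapid a) : X := SmoothFun.mk _ (contDiff_sqSeries ha).contDiffOn

theorem sqFun_apply {a : ℤ → ℂ} (ha : IsRapid a) {x : ℝ}
    (hx : x ∈ Ioo (-2 * Real.pi) (2 * Real.pi)) : sqFun ha x = sqSeries a x :=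
  SmoothFun.mk_apply _ hx

theorem derivLin_sqFun {a : ℤ → ℂ} (ha : IsRapid a) : dX (sqFun ha) = sqFun ha.sqMul :=
  derivLin_eq_of_hasDerivAt fun x hx => by
    rw [sqFun_apply _ hx]
    exact SmoothFun.hasDerivAt_of_eqOn hx (fun y hy => sqFun_apply ha hy)
      (hasDerivAt_sqSeries ha x)

theorem hasSum_coeff_sqFun {a : ℤ → ℂ} (ha : IsRapid a) (n : ℤ) :
    HasSum (fun k : ℤ => a k * if n = k ^ 2 then (2 * Real.pi : ℂ) else 0)
      (coeff n (sqFun ha)) := by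
  have hpi := Real.pi_pos
  let g : ℤ → C(ℝ, ℂ) := fun k => ⟨fun x => a k * (Complex.exp (-(n * Complex.I * x)) *
    Complex.exp ((k ^ 2 : ℤ) * Complex.I * x)), by fun_prop⟩
  have hsum : Summable fun k => ‖(g k).restrict
      (⟨uIcc (-Real.pi) Real.pi, isCompact_uIcc⟩ : TopologicalSpace.Compacts ℝ)‖ := by
    refine Summable.of_nonneg_of_le (fun _ => norm_nonneg _) (fun k => ?_) ha.summable_norm
    refine (ContinuousMap.norm_le _ (norm_nonneg _)).2 fun x => ?_
    change ‖a k * (Complex.exp (-(n * Complex.I * (x : ℝ))) *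
      Complex.exp ((k ^ 2 : ℤ) * Complex.I * (x : ℝ)))‖ ≤ _
    rw [norm_mul, norm_mul, norm_exp_I, norm_cexp_int_mul_I, mul_one, mul_one]
  have hint := intervalIntegral.hasSum_intervalIntegral_of_summable_norm
    (a := -Real.pi) (b := Real.pi) hsum
  have e1 : ∫ x in (-Real.pi)..Real.pi, ∑' k, g k x = coeff n (sqFun ha) := by
    rw [coeff_apply]
    refine intervalIntegral.integral_congr fun x hx => ?_
    rw [uIcc_of_le (by linarith)] at hx
    simp only [sqFun_apply ha (Icc_subset hx), sqSeries, ← tsum_mul_left]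
    refine tsum_congr fun k => ?_
    change a k * (_ * _) = _
    ring
  rw [e1] at hint
  refine hint.congr_fun fun k => ?_
  rw [← coeff_expo, coeff_apply, ← intervalIntegral.integral_const_mul]
  refine intervalIntegral.integral_congr fun x hx => ?_
  rw [uIcc_of_le (by linarith)] at hx
  simp only [expo_apply _ (Icc_subset hx)]
  rfl

theorem coeff_sq_sqFun {a : ℤ → ℂ} (ha : IsRapid a) (h0 : a 0 = 0) (m : ℤ) :
    coeff (m ^ 2) (sqFun ha) = 2 * Real.pi * (a m + a (-m)) := by
  rw [← (hasSum_coeff_sqFun ha (m ^ 2)).tsum_eq,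
    tsum_eq_sum (s := {m, -m}) fun k hk => by
      rw [if_neg fun h => hk (by simpa using sq_eq_sq_iff_eq_or_eq_neg.1 h.symm), mul_zero]]
  rcases eq_or_ne m 0 with rfl | hm
  · simp [h0]
  · rw [Finset.sum_pair (by omega)]
    simp
    ring

theorem theta_sqFun {a : ℤ → ℂ} (ha : IsRapid a) (h0 : a 0 = 0) :
    theta (sqFun ha) = 4 * Real.pi * ∑' k : ℤ, a k := by
  have hs : Summable a := ha.summable_norm.of_norm
  have hs' : Summable fun k : ℤ => a (-k) := (Equiv.neg ℤ).summable_iff.2 hs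
  rw [theta_apply]
  simp only [coeff_sq_sqFun ha h0]
  have hneg : ∑' k : ℤ, a (-k) = ∑' k : ℤ, a k := (Equiv.neg ℤ).tsum_eq a
  rw [tsum_mul_left, hs.tsum_add hs', hneg]
  ring

theorem sqFun_mem_thetaSpace {a : ℤ → ℂ} (ha : IsRapid a) (h0 : a 0 = 0)
    (h : ∀ j : ℕ, ∑' k : ℤ, (k : ℂ) ^ j * a k = 0) : sqFun ha ∈ thetaSpace := by
  refine mem_thetaSpace.2 fun j => ?_
  induction j generalizing a with
  | zero =>
    change theta (sqFun ha) = 0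
    have := h 0
    simp only [pow_zero, one_mul] at this
    rw [theta_sqFun ha h0, this, mul_zero]
  | succ j ih =>
    rw [pow_succ, Module.End.mul_apply, derivLin_sqFun]
    refine ih ha.sqMul (by simp [sqMul]) fun i => ?_
    have e : ∀ k : ℤ, (k : ℂ) ^ i * sqMul a k = Complex.I * ((k : ℂ) ^ (i + 2) * a k) := fun k => by
      rw [sqMul]; push_cast; ring
    simp only [e]
    rw [tsum_mul_left, h, mul_zero]

open scoped SchwartzMap FourierTransform

theorem fourier_derivCLM_apply (η : 𝓢(ℝ, ℂ)) (x : ℝ) :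
    𝓕 (SchwartzMap.derivCLM ℂ ℂ η) x = 2 * Real.pi * Complex.I * x * 𝓕 η x := by
  have h := Real.fourier_deriv η.integrable η.differentiable
    (SchwartzMap.derivCLM ℂ ℂ η).integrable
  exact congrFun h x

/-- By Poisson summation, the Fourier transform of a function supported between two consecutive
integers has vanishing moments over the integers. -/
theorem tsum_pow_mul_fourier_eq_zero (η : 𝓢(ℝ, ℂ)) (hη : tsupport η ⊆ Ioo 0 1) (j : ℕ) :
    ∑' k : ℤ, (k : ℂ) ^ j * 𝓕 η (k : ℝ) = 0 := by
  induction j generalizing η with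
  | zero =>
    have h := SchwartzMap.tsum_eq_tsum_fourier η 0
    have h0 : ∀ n : ℤ, η (0 + n) = 0 := fun n => by
      refine image_eq_zero_of_notMem_tsupport fun hn => ?_
      have h1 := hη hn
      rw [zero_add] at h1
      have h2 : (0 : ℤ) < n := by exact_mod_cast h1.1
      have h3 : n < (1 : ℤ) := by exact_mod_cast h1.2
      omega
    simp only [h0, tsum_zero] at h
    simpa using h.symm
  | succ j ih =>
    have h := ih (SchwartzMap.derivCLM ℂ ℂ η) ((SchwartzMap.tsupport_derivCLM_subset ℂ η).trans hη)
    have e : ∀ k : ℤ, (k : ℂ) ^ j * 𝓕 (SchwartzMap.derivCLM ℂ ℂ η) (k : ℝ) =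
        2 * Real.pi * Complex.I * ((k : ℂ) ^ (j + 1) * 𝓕 η (k : ℝ)) := fun k => by
      rw [fourier_derivCLM_apply]; push_cast; ring
    simp only [e] at h
    rw [tsum_mul_left] at h
    refine (mul_eq_zero.1 h).resolve_left ?_
    simp [Real.pi_ne_zero]

theorem isRapid_schwartz (g : 𝓢(ℝ, ℂ)) : IsRapid fun k : ℤ => g k := fun N => by
  obtain ⟨C, -, hC⟩ := g.decay N 0
  obtain ⟨C', -, hC'⟩ := g.decay (N + 2) 0
  refine (summable_inv_one_add_sq.mul_left (C + C')).of_nonneg_of_le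
    (fun k => by positivity) fun k => ?_
  have h1 := hC k
  have h2 := hC' k
  rw [norm_iteratedFDeriv_zero, Real.norm_eq_abs] at h1 h2
  rw [mul_one_div, le_div_iff₀ (by positivity)]
  rw [pow_add, sq_abs] at h2
  nlinarith

/-- A rapidly decreasing sequence all of whose moments vanish, supported off `0`, and with nonzero
even part at `1`. -/
theorem exists_isRapid_moments_eq_zero : ∃ a : ℤ → ℂ, IsRapid a ∧ a 0 = 0 ∧
    (∀ j : ℕ, ∑' k : ℤ, (k : ℂ) ^ j * a k = 0) ∧ a 1 + a (-1) ≠ 0 := by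
  let φ : ContDiffBump (1 / 2 : ℝ) := ⟨1 / 8, 1 / 4, by norm_num, by norm_num⟩
  have hφc : HasCompactSupport fun x => (φ x : ℂ) := φ.hasCompactSupport.comp_left
    (g := fun y : ℝ => (y : ℂ)) Complex.ofReal_zero
  let η : 𝓢(ℝ, ℂ) := hφc.toSchwartzMap (Complex.ofRealCLM.contDiff.comp φ.contDiff)
  have hηφ : ∀ x, η x = (φ x : ℂ) := fun x => rfl
  have hsupp : tsupport η ⊆ Ioo 0 1 := by
    refine (tsupport_comp_subset (g := fun y : ℝ => (y : ℂ)) Complex.ofReal_zero φ).trans ?_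
    rw [φ.tsupport_eq, Real.closedBall_eq_Icc]
    exact Icc_subset_Ioo (by norm_num [φ]) (by norm_num [φ])
  have hmom := tsum_pow_mul_fourier_eq_zero η hsupp
  have hrapid := isRapid_schwartz (𝓕 η)
  refine ⟨fun k => (k : ℂ) ^ 2 * 𝓕 η (k : ℝ), fun N => ?_, by simp, fun j => ?_, ?_⟩
  · refine (hrapid (N + 2)).congr fun k => ?_
    rw [norm_mul, norm_pow, Complex.norm_intCast]; ring
  · rw [← hmom (j + 2)]
    exact tsum_congr fun k => by ring
  · -- This number is twice the integral of `cos (2 π x) φ(x)`, and the cosine is negative on the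
    -- support `(1/4, 3/4)` of `φ`.
    have hcos : ∀ x : ℝ, 0 ≤ -Real.cos (2 * Real.pi * x) * φ x := fun x => by
      by_cases hx : x ∈ Function.support φ
      · rw [φ.support_eq, Real.ball_eq_Ioo] at hx
        have h1 : (1 / 4 : ℝ) < x := by have := hx.1; norm_num [φ] at this; linarith
        have h2 : x < (3 / 4 : ℝ) := by have := hx.2; norm_num [φ] at this; linarith
        have hpi := Real.pi_pos
        have := Real.cos_nonpos_of_pi_div_two_le_of_le (x := 2 * Real.pi * x)
          (by nlinarith) (by nlinarith)
        exact mul_nonneg (by linarith) φ.nonneg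
      · rw [Function.notMem_support.1 hx, mul_zero]
    have hpos : 0 < ∫ x, -Real.cos (2 * Real.pi * x) * φ x := by
      refine Continuous.integral_pos_of_hasCompactSupport_nonneg_nonzero (x := 1 / 2) ?_
        φ.hasCompactSupport.mul_left hcos ?_
      · exact Continuous.mul (by fun_prop) φ.continuous
      · have h1 : φ (1 / 2) = 1 := φ.one_of_mem_closedBall (Metric.mem_closedBall_self φ.rIn_pos.le)
        have h2 : 2 * Real.pi * (1 / 2) = Real.pi := by ring
        rw [h1, h2]
        simp
    have hint : ∀ n : ℤ, Integrable fun x : ℝ =>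
        Complex.exp (-(2 * Real.pi * Complex.I * n * x)) * (φ x : ℂ) := fun n => by
      refine Continuous.integrable_of_hasCompactSupport ?_ hφc.mul_left
      exact Continuous.mul (by fun_prop) (Complex.continuous_ofReal.comp φ.continuous)
    have hF : ∀ n : ℤ, 𝓕 η (n : ℝ) =
        ∫ x : ℝ, Complex.exp (-(2 * Real.pi * Complex.I * n * x)) * (φ x : ℂ) := fun n => by
      rw [SchwartzMap.fourier_coe, Real.fourier_real_eq_integral_exp_smul]
      refine integral_congr_ae (Eventually.of_forall fun x => ?_)
      simp only [hηφ, smul_eq_mul]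
      congr 2
      push_cast; ring
    have hsumeq : 𝓕 η ((1 : ℤ) : ℝ) + 𝓕 η ((-1 : ℤ) : ℝ) =
        ((-2 * ∫ x, -Real.cos (2 * Real.pi * x) * φ x : ℝ) : ℂ) := by
      rw [hF, hF, ← integral_add (hint _) (hint _), ← integral_const_mul, ← integral_complex_ofReal]
      refine integral_congr_ae (Eventually.of_forall fun x => ?_)
      simp only
      push_cast
      rw [Complex.cos]
      have e1 : -(2 * (Real.pi : ℂ) * Complex.I * 1 * x) = -(2 * Real.pi * x) * Complex.I := by ring
      have e2 : -(2 * (Real.pi : ℂ) * Complex.I * (-1) * x) = (2 * Real.pi * x) * Complex.I := by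
        ring
      rw [e1, e2]
      ring
    have e : (((1 : ℤ) : ℂ) ^ 2 * 𝓕 η ((1 : ℤ) : ℝ) + ((-1 : ℤ) : ℂ) ^ 2 * 𝓕 η ((-1 : ℤ) : ℝ)) =
        𝓕 η ((1 : ℤ) : ℝ) + 𝓕 η ((-1 : ℤ) : ℝ) := by
      push_cast; ring
    rw [e, hsumeq, Complex.ofReal_ne_zero]
    linarith

/-- Since the eigenvalues are semisimple, only pure exponentials occur in `thetaSpace`. -/
theorem monomialExp_mem_thetaSpace {n : ℕ} {z : ℂ}
    (h : monomialExp (-2 * Real.pi) (2 * Real.pi) n z ∈ thetaSpace) :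
    n = 0 ∧ theta (expo z) = 0 := by
  cases n with
  | zero => exact ⟨rfl, theta_eq_zero h⟩
  | succ n =>
    exfalso
    have key : ∀ n : ℕ, ((dX - z • 1) ^ (n + 1)) (monomialExp _ _ n z) = 0 := by
      intro n
      induction n with
      | zero =>
        rw [zero_add, pow_one]
        exact sub_eq_zero.2 (derivLin_expo z)
      | succ n ih =>
        have e : (dX - z • 1) (monomialExp _ _ (n + 1) z) = ((n : ℂ) + 1) • monomialExp _ _ n z :=
          derivLin_monomialExp_succ n z
        rw [pow_succ, Module.End.mul_apply, e, map_smul, ih, smul_zero]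
    have h1 := derivLin_sub_eq_zero_of_pow h _ (key (n + 1))
    rw [derivLin_monomialExp_succ] at h1
    have h2 := (smul_eq_zero.1 h1).resolve_left (by exact_mod_cast n.succ_ne_zero)
    have h3 : monomialExp (-2 * Real.pi) (2 * Real.pi) n z 1 = 0 := by rw [h2]; rfl
    have h1mem : (1 : ℝ) ∈ Ioo (-2 * Real.pi) (2 * Real.pi) :=
      Icc_subset ⟨by linarith [Real.pi_gt_three], by linarith [Real.pi_gt_three]⟩
    rw [monomialExp_apply n z h1mem] at h3
    simp at h3

/-- The first Fourier coefficient vanishes on the synthesizable part of `thetaSpace`. -/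
theorem synthesisPart_le : synthesisPart thetaSpace ≤ LinearMap.ker (coeff 1) := by
  have hcl : IsClosed (LinearMap.ker (coeff 1) : Set X) :=
    isClosed_eq (continuous_coeff 1) continuous_const
  refine Submodule.topologicalClosure_minimal _ (sup_le ?_ (Submodule.span_le.2 ?_)) hcl
  · rw [residualPart_thetaSpace]
    exact fun f hf => coeff_eq_zero_of_mem_vanishing hf 1
  · rintro f ⟨hf, n, z, rfl⟩
    obtain ⟨rfl, hz⟩ := monomialExp_mem_thetaSpace hf
    obtain ⟨n, rfl, hn⟩ := theta_expo_eq_zero_iff.1 hz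
    have : (1 : ℤ) ≠ n := fun h => hn 1 (by rw [← h]; norm_num)
    exact (coeff_expo 1 n).trans (if_neg this)

theorem thetaSpace_ne_synthesisPart : thetaSpace ≠ synthesisPart thetaSpace := by
  obtain ⟨a, ha, h0, hmom, h1⟩ := exists_isRapid_moments_eq_zero
  intro h
  have h2 := sqFun_mem_thetaSpace ha h0 hmom
  rw [h] at h2
  have h3 : coeff 1 (sqFun ha) = 0 := synthesisPart_le h2
  have h4 := coeff_sq_sqFun ha h0 1
  rw [one_pow, h3] at h4
  refine h1 ((mul_eq_zero.1 h4.symm).resolve_left ?_)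
  simp [Real.pi_ne_zero]

end DiffInv

end

theorem theorem2 :
    ∃ (L : Submodule ℂ (DiffInv.SmoothFun (-2 * Real.pi) (2 * Real.pi)))
      (hL : DiffInv.IsInvariantSubspace L),
      DiffInv.HasDiscreteSpectrum hL ∧
      (DiffInv.residualPart L : Set (DiffInv.SmoothFun (-2 * Real.pi) (2 * Real.pi))) =
        {f | ∀ x ∈ Icc (-Real.pi) Real.pi, f x = 0} ∧
      DiffInv.HasUpperDensity hL 1 ∧
      L ≠ DiffInv.synthesisPart L :=
  ⟨DiffInv.thetaSpace, DiffInv.isInvariant_thetaSpace, DiffInv.hasDiscreteSpectrum_thetaSpace,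
    by rw [DiffInv.residualPart_thetaSpace]; rfl, DiffInv.hasUpperDensity_thetaSpace,
    DiffInv.thetaSpace_ne_synthesisPart⟩
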